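/- Let $G=(V,E)$ be a finite undirected network with $m$ nodes; write $\mathcal N(v)$ for the set consisting of $v$ and its neighbours. Let $\{f(\cdot;\theta):\theta\in\Theta\}$ be a family of discrete distributions on a set $S\subseteq\mathbb R$ with $f(x;\theta)>0$ for all $x\in S,\ \theta\in\Theta$, and with finite means $\mu(\theta)$; let $kl(\beta\|\lambda)$ be the Kullback–Leibler divergence of $f(\cdot;\lambda)$ from $f(\cdot;\beta)$. Every node faces the same $K$-armed bandit with parameter vector $\boldsymbol\theta=(\theta_1,\dots,\theta_K)\in\Theta^K$: in each round $t=1,2,\dots$ each node $v$ chooses an arm $a^v(t)$ and receives an independent reward drawn from $f(\cdot;\theta_{a^v(t)})$; a policy of $v$ chooses (possibly at random) the arm of round $t$ from the actions and rewards of the nodes of $\mathcal N(v)$ in the rounds before $t$. Let $T_i^v(n)$ be the number of times $v$ plays arm $i$ in rounds $1,\dots,n$, $m_i^v(n)=\sum_{u\in\mathcal N(v)}T_i^u(n)$ and $m_i^G(n)=\sum_{u\in V}T_i^u(n)$. Arm $i$ is sub-optimal under $\boldsymbol\theta$ if $\mu(\theta_i)<\max_k\mu(\theta_k)$. Let $\omega_{\bar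 v}$ denote a sequence of actions and rewards (in $S$) of the nodes outside $\mathcal N(v)$ over all rounds; for horizon $n$ its first $n$ rounds are used. $\mathbb E_{\boldsymbol\theta}[\,\cdot\mid\omega_{\bar v}]$ denotes expectation when the actions and rewards outside $\mathcal N(v)$ are held fixed at $\omega_{\bar v}$, while the nodes of $\mathcal N(v)$ follow their policies and receive independent rewards from the distributions of the arms they play. [A1]: (i) $0<kl(\beta\|\lambda)<\infty$ whenever $\mu(\lambda)>\mu(\beta)$; (ii) for all $\epsilon>0$ and $\beta,\lambda$ with $\mu(\lambda)>\mu(\beta)$ there is $\eta>0$ such that $|kl(\beta\|\lambda)-kl(\beta\|\lambda')|<\epsilon$ whenever $\mu(\lambda)\le\mu(\lambda')\le\mu(\lambda)+\eta$; (iii) for all $\lambda\in\Theta$, $\eta>0$ there is $\lambda'\in\Theta$ with $\mu(\lambda)<\mu(\lambda')<\mu(\lambda)+\eta$. A policy of $v$ is *individually consistent* if for every $\boldsymbol\theta\in\Theta^K$, every arm $i$ sub-optimal under $\boldsymbol\theta$, all policies of the nodes in $\mathcal N(v)\setminus\{v\}$, every $\omega_{\bar v}$ and every $a>0$, $\mathbb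 E_{\boldsymbol\theta}[T_i^v(n)\mid\omega_{\bar v}]=o(n^a)$ as $n\to\infty$. It is *non-altruistic* if for every $\boldsymbol\theta\in\Theta^K$ there are constants $a_1,a_2$ such that for every $n$, every arm $i$ sub-optimal under $\boldsymbol\theta$ and all policies of the other nodes, the expected number of rounds $t\le n$ in which $v$ plays arm $i$ with $m_i^v(t-1)\ge a_1\ln n$ is at most $a_2$. It is NAIC if it is both. **Theorem.** Assume [A1], let every node follow an NAIC policy, let $\boldsymbol\theta\in\Theta^K$, let arm $j$ be sub-optimal under $\boldsymbol\theta$, let $\theta^*$ be the parameter of an arm with the largest mean, and let $\delta\in(0,1)$. Then: (i) for every node $v$ and every $\omega_{\bar v}$, $$\liminf_{n\to\infty}\frac{\mathbb E_{\boldsymbol\theta}[m_j^v(n)\mid\omega_{\bar v}]}{\ln n}\ge\frac{1-\delta}{1+\delta}\cdot\frac1{kl(\theta_j\|\theta^*)},\qquad \liminf_{n\to\infty}\frac{\mathbb E_{\boldsymbol\theta}[m_j^v(n)]}{\ln n}\ge\frac{1-\delta}{1+\delta}\cdot\frac1{kl(\theta_j\|\theta^*)};$$ (ii) $$\liminf_{n\to\infty}\frac{\mathbb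 E_{\boldsymbol\theta}[m_j^G(n)]}{\ln n}\ge L_G\cdot\frac{1-\delta}{1+\delta}\cdot\frac1{kl(\theta_j\|\theta^*)},$$ where $L_G\,q$, for $q>0$, is the minimum of $\|z_m\|_1$ over all enumerations $\eta_1,\dots,\eta_m$ of $V$ and all sequences of vectors $0\le z_1\le z_2\le\dots\le z_m$ in $\mathbb R^V$ (coordinatewise order) with $z_i(\eta_k)=z_k(\eta_k)$ for all $i\ge k$ and $\sum_{u\in\mathcal N(\eta_k)}z_k(u)\ge q$ for all $k$; the number $L_G$ does not depend on $q$. -/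

import Mathlib

open Filter Asymptotics MeasureTheory
open scoped ENNReal NNReal Topology

noncomputable section

namespace NetBandit

/-! ### Network, policies and sample paths -/

open Classical in
/-- `𝒩(v)`: the node `v` together with its one-hop neighbours. -/
def nbhd {V : Type*} [Fintype V] (G : SimpleGraph V) (v : V) : Finset V :=
  Finset.univ.filter fun u => u = v ∨ G.Adj v u

/-- A (possibly randomised) policy of node `v`: for every `t`, given the actions and rewards of all
nodes of `𝒩(v)` in the first `t` rounds, a distribution for the next arm.  A deterministic policy
is one all of whose values are point masses. -/
abbrev Policy {V : Type*} [Fintype V] (G : SimpleGraph V) (K : ℕ) (S : Set ℝ) (v : V) : Type _ :=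
  (t : ℕ) → (Fin t → {u // u ∈ nbhd G v} → Fin K × S) → PMF (Fin K)

/-- A sample path over `n` rounds: the action and the reward of every node in every round. -/
abbrev Path (V : Type*) (K : ℕ) (S : Set ℝ) (n : ℕ) : Type _ :=
  Fin n → V → Fin K × S

/-- A trajectory of the nodes outside `𝒩(v)`; its first `n` rounds are used for horizon `n`. -/
abbrev OutsidePath {V : Type*} [Fintype V] (G : SimpleGraph V) (K : ℕ) (S : Set ℝ) (v : V) :
    Type _ :=
  ℕ → {u // u ∉ nbhd G v} → Fin K × S

section Model

variable {V : Type*} [Fintype V] {G : SimpleGraph V} {K : ℕ} {S : Set ℝ} {Θ : Type*}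

/-- What node `u` has observed on the path `ω` before it acts in round `t`. -/
def observed (G : SimpleGraph V) {n : ℕ} (ω : Path V K S n) (t : Fin n) (u : V) :
    Fin t → {w // w ∈ nbhd G u} → Fin K × S :=
  fun s w => ω ⟨s, s.2.trans t.2⟩ w

/-- The conditional probability, given the past, that node `u` takes in round `t` the action that
`ω` prescribes and receives the reward that `ω` prescribes. -/
def stepProb (f : Θ → PMF S) (Φ : (v : V) → Policy G K S v) (θ : Fin K → Θ) {n : ℕ}
    (ω : Path V K S n) (t : Fin n) (u : V) : ℝ≥0∞ :=
  Φ u t (observed G ω t u) (ω t u).1 * f (θ (ω t u).1) (ω t u).2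

/-- `𝔼_θ[F]` for a function `F` of the sample path over `n` rounds, when the network uses `Φ`. -/
def expect (f : Θ → PMF S) (Φ : (v : V) → Policy G K S v) (θ : Fin K → Θ) (n : ℕ)
    (F : Path V K S n → ℝ≥0∞) : ℝ≥0∞ :=
  ∑' ω : Path V K S n, (∏ t, ∏ u, stepProb f Φ θ ω t u) * F ω

open Classical in
/-- The sample path with the trajectory `x` on `𝒩(v)` and the trajectory `b` outside `𝒩(v)`. -/
def glue {v : V} (b : OutsidePath G K S v) {n : ℕ}
    (x : Fin n → {u // u ∈ nbhd G v} → Fin K × S) : Path V K S n :=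
  fun t u => if h : u ∈ nbhd G v then x t ⟨u, h⟩ else b t ⟨u, h⟩

/-- `𝔼_θ[F ∣ ω_{v̄} = b]`: the actions and rewards of the nodes outside `𝒩(v)` are those of `b`,
while the nodes of `𝒩(v)` act by their policies (on what they observe, which includes `b`) and
receive fresh rewards.  The policies of the nodes outside `𝒩(v)` play no role. -/
def condExpect (f : Θ → PMF S) (Φ : (v : V) → Policy G K S v) (θ : Fin K → Θ) (v : V)
    (b : OutsidePath G K S v) (n : ℕ) (F : Path V K S n → ℝ≥0∞) : ℝ≥0∞ :=
  ∑' x : Fin n → {u // u ∈ nbhd G v} → Fin K × S,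
    (∏ t, ∏ u ∈ nbhd G v, stepProb f Φ θ (glue b x) t u) * F (glue b x)

/-! ### Counts -/

/-- `T_i^u(n)`: how often node `u` plays arm `i` on the path. -/
def pulls (i : Fin K) (u : V) {n : ℕ} (ω : Path V K S n) : ℕ :=
  (Finset.univ.filter fun t : Fin n => (ω t u).1 = i).card

/-- `m_i^v(n)`: how often arm `i` is played in `𝒩(v)` on the path. -/
def nbhdPulls (G : SimpleGraph V) (i : Fin K) (v : V) {n : ℕ} (ω : Path V K S n) : ℕ :=
  ∑ u ∈ nbhd G v, pulls i u ω

/-- `m_i^G(n)`: how often arm `i` is played in the whole network on the path. -/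
def netPulls (i : Fin K) {n : ℕ} (ω : Path V K S n) : ℕ :=
  ∑ u, pulls i u ω

/-- How often arm `i` is played in `𝒩(v)` in the rounds strictly before round `t`. -/
def nbhdPullsBefore (G : SimpleGraph V) (i : Fin K) (v : V) {n : ℕ} (ω : Path V K S n)
    (t : Fin n) : ℕ :=
  ∑ u ∈ nbhd G v, (Finset.univ.filter fun s : Fin n => s < t ∧ (ω s u).1 = i).card

open Classical in
/-- How often node `v` plays arm `i` after it has obtained at least `c` samples of that arm. -/
def pullsAfter (G : SimpleGraph V) (i : Fin K) (v : V) (c : ℝ) {n : ℕ} (ω : Path V K S n) : ℕ :=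
  (Finset.univ.filter fun t : Fin n =>
    (ω t v).1 = i ∧ c ≤ (nbhdPullsBefore G i v ω t : ℝ)).card

/-! ### The parametric family of reward distributions -/

/-- Mean reward of a distribution on `S`. -/
def mean (p : PMF S) : ℝ := ∫ x : S, (x : ℝ) ∂p.toMeasure

/-- Kullback–Leibler divergence `kl(β ‖ lam)`. -/
def kl (f : Θ → PMF S) (β lam : Θ) : ℝ≥0∞ :=
  InformationTheory.klDiv (f β).toMeasure (f lam).toMeasure

/-- Arm `i` is sub-optimal under `θ`. -/
def Suboptimal (f : Θ → PMF S) (θ : Fin K → Θ) (i : Fin K) : Prop :=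
  ∃ k, mean (f (θ i)) < mean (f (θ k))

/-- Arm `i` has the highest mean under `θ`. -/
def Optimal (f : Θ → PMF S) (θ : Fin K → Θ) (i : Fin K) : Prop :=
  ∀ k, mean (f (θ k)) ≤ mean (f (θ i))

/-- The Lai–Robbins type regularity assumptions on the parametric family. -/
structure A1 (f : Θ → PMF S) : Prop where
  pos_finite : ∀ β lam, mean (f β) < mean (f lam) → 0 < kl f β lam ∧ kl f β lam < ∞
  continuity : ∀ ε : ℝ, 0 < ε → ∀ β lam, mean (f β) < mean (f lam) → ∃ η : ℝ, 0 < η ∧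
    ∀ lam', mean (f lam) ≤ mean (f lam') → mean (f lam') ≤ mean (f lam) + η →
      |(kl f β lam).toReal - (kl f β lam').toReal| < ε
  denseness : ∀ lam, ∀ η : ℝ, 0 < η →
    ∃ lam', mean (f lam) < mean (f lam') ∧ mean (f lam') < mean (f lam) + η

/-! ### NAIC policies -/

/-- Individual consistency of a policy `φ` of node `v`. -/
def IndividuallyConsistent (f : Θ → PMF S) (v : V) (φ : Policy G K S v) : Prop :=
  ∀ (θ : Fin K → Θ) (i : Fin K), Suboptimal f θ i →
    ∀ Φ : (u : V) → Policy G K S u, Φ v = φ →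
      ∀ (b : OutsidePath G K S v) (a : ℝ), 0 < a →
        (fun n : ℕ => (condExpect f Φ θ v b n fun ω => (pulls i v ω : ℝ≥0∞)).toReal)
          =o[atTop] fun n : ℕ => (n : ℝ) ^ a

/-- Non-altruism of a policy `φ` of node `v`. -/
def NonAltruistic (f : Θ → PMF S) (v : V) (φ : Policy G K S v) : Prop :=
  ∀ θ : Fin K → Θ, ∃ (a₁ : ℝ) (a₂ : ℝ≥0), ∀ (n : ℕ) (i : Fin K), Suboptimal f θ i →
    ∀ Φ : (u : V) → Policy G K S u, Φ v = φ →
      (expect f Φ θ n fun ω => (pullsAfter G i v (a₁ * Real.log n) ω : ℝ≥0∞)) ≤ a₂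

/-- Non-altruistic and individually consistent policies. -/
def NAIC (f : Θ → PMF S) (v : V) (φ : Policy G K S v) : Prop :=
  NonAltruistic f v φ ∧ IndividuallyConsistent f v φ

end Model

/-! ### The optimisation problem -/

section Optimisation

variable {V : Type*} [Fintype V]

/-- Feasibility: `η` enumerates the nodes and `z k` is the vector of counts (non-negative,
non-decreasing in `k`) when the node `η k` has reached the threshold `q`; the count of `η k` does
not change afterwards. -/
structure Feasible (G : SimpleGraph V) (q : ℝ) (η : Fin (Fintype.card V) ≃ V)
    (z : Fin (Fintype.card V) → V → ℝ) : Prop where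
  nonneg : ∀ k v, 0 ≤ z k v
  mono : Monotone z
  frozen : ∀ k i, k ≤ i → z i (η k) = z k (η k)
  threshold : ∀ k, q ≤ ∑ u ∈ nbhd G (η k), z k u

/-- The attainable values of `‖z_m‖₁`, where `m` is the number of nodes. -/
def totals (G : SimpleGraph V) (q : ℝ) : Set ℝ :=
  {s | ∃ η z, Feasible G q η z ∧
    ∃ last : Fin (Fintype.card V), (last : ℕ) + 1 = Fintype.card V ∧ s = ∑ v, |z last v|}

/-- The value of the optimisation problem with threshold `q`. -/
def minTotal (G : SimpleGraph V) (q : ℝ) : ℝ := sInf (totals G q)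

/-- `L_G`: the value of the optimisation problem divided by its threshold; by `minTotal_div` below
it does not depend on the threshold, which is taken to be `1`. -/
def graphConst (G : SimpleGraph V) : ℝ := minTotal G 1

theorem totals_smul (G : SimpleGraph V) {c q s : ℝ} (hc : 0 < c) (hs : s ∈ totals G q) :
    c * s ∈ totals G (c * q) := by
  obtain ⟨η, z, h, l, hl, rfl⟩ := hs
  refine ⟨η, fun k v => c * z k v, ⟨?_, ?_, ?_, ?_⟩, l, hl, ?_⟩
  · exact fun k v => mul_nonneg hc.le (h.nonneg k v)
  · exact fun a b hab v => mul_le_mul_of_nonneg_left (h.mono hab v) hc.le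
  · exact fun k i hki => by simp only [h.frozen k i hki]
  · intro k
    rw [← Finset.mul_sum]
    exact mul_le_mul_of_nonneg_left (h.threshold k) hc.le
  · simp only [abs_mul, abs_of_pos hc, Finset.mul_sum]

open scoped Pointwise in
theorem minTotal_div (G : SimpleGraph V) {q : ℝ} (hq : 0 < q) :
    minTotal G q / q = graphConst G := by
  have key : totals G q = q • totals G 1 := by
    ext s
    rw [Set.mem_smul_set]
    constructor
    · intro hs
      refine ⟨q⁻¹ * s, ?_, ?_⟩
      · have := totals_smul G (inv_pos.mpr hq) hs
        rwa [inv_mul_cancel₀ hq.ne'] at this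
      · rw [smul_eq_mul, mul_inv_cancel_left₀ hq.ne']
    · rintro ⟨y, hy, rfl⟩
      have := totals_smul G hq hy
      rwa [mul_one] at this
  rw [minTotal, key, Real.sInf_smul_of_nonneg hq.le, smul_eq_mul, graphConst, minTotal,
    mul_div_cancel_left₀ _ hq.ne']

end Optimisation

end NetBandit

end

open NetBandit

noncomputable section

namespace NetBandit

/-! ### Sums over product spaces and over paths -/

/-! The argument is a Lai–Robbins change of measure. Raise the parameter of the sub-optimal arm `j`
to one whose mean lies just above the best mean and whose divergence from `θ j` is almost `kl f (θ
j) (θ star)`. Then every other arm is sub-optimal, so a good policy of `v` plays the others rarely,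
and fewer than `q log n` plays of `j` in `𝒩(v)` is very unlikely. Return to the original law: on
that event the likelihood ratio is at most about `exp (κ q log n) = n ^ (κ q)`, up to a small
exceptional probability, and with `q κ < 1` this is too small to make the event likely. Hence `𝒩(v)`
plays `j` at least `q log n` times with probability tending to one (`tendsto_count_lt`). The ratio
is controlled by a weak law for the sum of at most `N` rewards (`weak_law_arm`), which needs only a
first moment.

With the outside trajectory fixed, the learners are exactly the nodes of `𝒩(v)`, and individual
consistency limits the other arms. Without conditioning, the parameter is changed only inside
`𝒩(v)`, so that the likelihood ratio sees only the plays there. The result is not a bandit network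
with one common parameter vector, but for functions of the actions it is a mixture of such networks,
in which nodes read the outside rewards of `j` from an independent tape (`sysExpect_hybrid`).
Non-altruism has constants uniform over the other policies, so it survives the mixture.

For the whole network, stop each node once its neighbourhood has enough samples of `j`. The counts,
nodes ordered by stopping time, are feasible for the optimisation problem up to the plays after
stopping (`graphConst_mul_le_netPulls`). Non-altruism keeps those bounded in expectation, hence
negligible against `log n`. -/

theorem tsum_fin_pi_prod {Y : Type*} : ∀ {n : ℕ} (k : Fin n → Y → ℝ≥0∞),
    ∑' x : Fin n → Y, ∏ u, k u (x u) = ∏ u, ∑' y, k u y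
  | 0, k => by simp
  | n + 1, k => by
    rw [← (Fin.consEquiv fun _ : Fin (n + 1) => Y).tsum_eq, ENNReal.tsum_prod', Fin.prod_univ_succ,
      ← tsum_fin_pi_prod fun u => k u.succ]
    simp_rw [Fin.prod_univ_succ, Fin.consEquiv_apply, Fin.cons_zero, Fin.cons_succ,
      ENNReal.tsum_mul_left, ENNReal.tsum_mul_right]

theorem tsum_pi_prod {I Y : Type*} [Fintype I] (k : I → Y → ℝ≥0∞) :
    ∑' x : I → Y, ∏ u, k u (x u) = ∏ u, ∑' y, k u y := by
  let e := Fintype.equivFin I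
  rw [← (Equiv.arrowCongr e.symm (Equiv.refl Y)).tsum_eq, ← e.symm.prod_comp,
    ← tsum_fin_pi_prod fun u => k (e.symm u)]
  refine tsum_congr fun x => ?_
  rw [← e.symm.prod_comp]
  simp

/-- The part of the path `ω` before round `t`. -/
def hist {X : Type*} {n : ℕ} (ω : Fin n → X) (t : Fin n) : Fin t → X :=
  fun s => ω ⟨s, s.2.trans t.2⟩

/-- The factors of earlier rounds do not see the last round, so it can be summed out first; this
drives the inductions on the horizon. -/
theorem tsum_path_succ {X : Type*} (κ : (t : ℕ) → (Fin t → X) → X → ℝ≥0∞) (n : ℕ) :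
    ∑' ω : Fin (n + 1) → X, ∏ t : Fin (n + 1), κ t (hist ω t) (ω t) =
      ∑' ω : Fin n → X, (∏ t : Fin n, κ t (hist ω t) (ω t)) * ∑' x, κ n ω x := by
  rw [← (Fin.snocEquiv fun _ : Fin (n + 1) => X).tsum_eq, ENNReal.tsum_prod',
    ENNReal.tsum_comm]
  refine tsum_congr fun ω => ?_
  rw [← ENNReal.tsum_mul_left]
  refine tsum_congr fun x => ?_
  rw [Fin.prod_univ_castSucc]
  congr 1
  · refine Finset.prod_congr rfl fun t _ => ?_
    have h1 : hist (Fin.snoc (α := fun _ => X) ω x) t.castSucc = hist ω t := by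
      funext s
      exact Fin.snoc_castSucc (α := fun _ => X) (i := ⟨s, s.2.trans t.2⟩) ..
    simp only [Fin.snocEquiv_apply, Fin.snoc_castSucc]
    exact congrArg (fun h => κ t h (ω t)) h1
  · have h1 : hist (Fin.snoc (α := fun _ => X) ω x) (Fin.last n) = ω := by
      funext s
      exact Fin.snoc_castSucc (α := fun _ => X) (i := s) ..
    simp only [Fin.snocEquiv_apply, Fin.snoc_last]
    exact congrArg (fun h => κ n h x) h1

theorem tsum_path_le_one {X : Type*} (κ : (t : ℕ) → (Fin t → X) → X → ℝ≥0∞)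
    (hκ : ∀ t h, ∑' x, κ t h x ≤ 1) :
    ∀ n, ∑' ω : Fin n → X, ∏ t : Fin n, κ t (hist ω t) (ω t) ≤ 1
  | 0 => by simp
  | n + 1 => by
    rw [tsum_path_succ]
    refine le_trans (ENNReal.tsum_le_tsum fun ω => ?_) (tsum_path_le_one κ hκ n)
    exact mul_le_of_le_one_right' (hκ n ω)

theorem tsum_path_eq_one {X : Type*} (κ : (t : ℕ) → (Fin t → X) → X → ℝ≥0∞)
    (hκ : ∀ t h, ∑' x, κ t h x = 1) :
    ∀ n, ∑' ω : Fin n → X, ∏ t : Fin n, κ t (hist ω t) (ω t) = 1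
  | 0 => by simp
  | n + 1 => by
    rw [tsum_path_succ]
    simp_rw [hκ, mul_one]
    exact tsum_path_eq_one κ hκ n

/-! ### Systems of learners -/

section System

variable {I : Type*} [Fintype I] {K : ℕ} {S : Set ℝ}

/-- Policies of a system of learners with full information about the past. -/
abbrev SysPolicy (I : Type*) (K : ℕ) (S : Set ℝ) : Type _ :=
  (t : ℕ) → (Fin t → I → Fin K × S) → I → PMF (Fin K)

/-- Probability of a path when learner `u` receives rewards drawn from `g u a` for arm `a`. -/
def sysProb (π : SysPolicy I K S) (g : I → Fin K → PMF S) {n : ℕ} (ω : Path I K S n) : ℝ≥0∞ :=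
  ∏ t : Fin n, ∏ u, π t (hist ω t) u (ω t u).1 * g u (ω t u).1 (ω t u).2

/-- Expectation of a function of the path over `n` rounds. -/
def sysExpect (π : SysPolicy I K S) (g : I → Fin K → PMF S) (n : ℕ) (F : Path I K S n → ℝ≥0∞) :
    ℝ≥0∞ :=
  ∑' ω, sysProb π g ω * F ω

open Classical in
/-- The indicator function of a proposition. -/
def ind (p : Prop) : ℝ≥0∞ := if p then 1 else 0

theorem ind_of {p : Prop} (h : p) : ind p = 1 := if_pos h

theorem ind_of_not {p : Prop} (h : ¬p) : ind p = 0 := if_neg h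

open Classical in
/-- Product of the weights `w` of the rewards that the learners in `D` receive from arm `j`. -/
def tilt (D : Finset I) (j : Fin K) (w : S → ℝ≥0∞) {n : ℕ} (ω : Path I K S n) : ℝ≥0∞ :=
  ∏ t, ∏ u, if u ∈ D ∧ (ω t u).1 = j then w (ω t u).2 else 1

/-- Number of times that the learners in `D` play arm `j`. -/
def count {V : Type*} (D : Finset V) (j : Fin K) {n : ℕ} (ω : Path V K S n) : ℕ :=
  ∑ u ∈ D, pulls j u ω

variable (π : SysPolicy I K S) (g : I → Fin K → PMF S)

theorem sysExpect_mono {n : ℕ} {F F' : Path I K S n → ℝ≥0∞} (h : ∀ ω, F ω ≤ F' ω) :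
    sysExpect π g n F ≤ sysExpect π g n F' :=
  ENNReal.tsum_le_tsum fun ω => mul_le_mul_right (h ω) _

theorem sysExpect_add {n : ℕ} (F F' : Path I K S n → ℝ≥0∞) :
    sysExpect π g n (fun ω => F ω + F' ω) = sysExpect π g n F + sysExpect π g n F' := by
  simp only [sysExpect, mul_add, ENNReal.tsum_add]

theorem sysExpect_const_mul {n : ℕ} (c : ℝ≥0∞) (F : Path I K S n → ℝ≥0∞) :
    sysExpect π g n (fun ω => c * F ω) = c * sysExpect π g n F := by
  simp only [sysExpect, mul_left_comm _ c, ENNReal.tsum_mul_left]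

theorem sysExpect_sum {ι : Type*} (s : Finset ι) {n : ℕ} (F : ι → Path I K S n → ℝ≥0∞) :
    sysExpect π g n (fun ω => ∑ i ∈ s, F i ω) = ∑ i ∈ s, sysExpect π g n (F i) := by
  simp only [sysExpect, Finset.mul_sum]
  exact Summable.tsum_finsetSum fun _ _ => ENNReal.summable

theorem tsum_policy_mul (p : PMF (Fin K)) (k : Fin K → S → ℝ≥0∞)
    (c : ℝ≥0∞) (hk : ∀ a, ∑' x, k a x ≤ c) : ∑' y : Fin K × S, p y.1 * k y.1 y.2 ≤ c := by
  rw [ENNReal.tsum_prod']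
  calc ∑' a, ∑' x, p a * k a x ≤ ∑' a, p a * c := ENNReal.tsum_le_tsum fun a => by
        rw [ENNReal.tsum_mul_left]; exact mul_le_mul_right (hk a) _
    _ = c := by rw [ENNReal.tsum_mul_right, p.tsum_coe, one_mul]

theorem sysExpect_one (n : ℕ) : sysExpect π g n (fun _ => 1) = 1 := by
  simp only [sysExpect, mul_one, sysProb]
  refine tsum_path_eq_one
    (fun t h (x : I → Fin K × S) => ∏ u, π t h u (x u).1 * g u (x u).1 (x u).2) (fun t h => ?_) n
  rw [tsum_pi_prod fun u (y : Fin K × S) => π t h u y.1 * g u y.1 y.2]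
  refine Finset.prod_eq_one fun u _ => ?_
  rw [ENNReal.tsum_prod']
  simp only [ENNReal.tsum_mul_left, PMF.tsum_coe, mul_one]

theorem sysExpect_const (n : ℕ) (c : ℝ≥0∞) : sysExpect π g n (fun _ => c) = c := by
  simpa [sysExpect_one] using sysExpect_const_mul π g (n := n) c (fun _ => 1)

/-- The weights turn the transition of every round into a sub-probability kernel, whatever the
policies are; the tilt is a supermartingale evaluated at the horizon. -/
theorem sysExpect_tilt_le_one (D : Finset I) (j : Fin K) (w : S → ℝ≥0∞)
    (hw : ∀ u ∈ D, ∑' x, g u j x * w x ≤ 1) (n : ℕ) : sysExpect π g n (tilt D j w) ≤ 1 := by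
  classical
  simp only [sysExpect, sysProb, tilt, ← Finset.prod_mul_distrib]
  refine tsum_path_le_one (fun t h (x : I → Fin K × S) => ∏ u, π t h u (x u).1 *
    g u (x u).1 (x u).2 * if u ∈ D ∧ (x u).1 = j then w (x u).2 else 1) (fun t h => ?_) n
  rw [tsum_pi_prod fun u (y : Fin K × S) => π t h u y.1 * g u y.1 y.2 *
    if u ∈ D ∧ y.1 = j then w y.2 else 1]
  refine Finset.prod_le_one' fun u _ => ?_
  simp only [mul_assoc]
  refine tsum_policy_mul (π t h u)
    (fun a x => g u a x * if u ∈ D ∧ a = j then w x else 1) 1 fun a => ?_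
  by_cases h1 : u ∈ D ∧ a = j
  · simp only [h1, and_self, if_true]
    exact hw u h1.1
  · simp [h1]

theorem tilt_mul_const (D : Finset I) (j : Fin K) (w : S → ℝ≥0∞) (c : ℝ≥0∞) {n : ℕ}
    (ω : Path I K S n) :
    tilt D j (fun x => w x * c) ω = tilt D j w ω * c ^ count D j ω := by
  classical
  have h : c ^ count D j ω = ∏ t, ∏ u, if u ∈ D ∧ (ω t u).1 = j then c else 1 := by
    rw [count, ← Finset.prod_pow_eq_pow_sum, Finset.prod_comm]
    rw [← Finset.prod_subset (Finset.subset_univ D)]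
    · refine Finset.prod_congr rfl fun u hu => ?_
      simp [hu, pulls, Finset.prod_ite]
    · intro u _ hu
      simp [hu]
  rw [h, tilt, tilt, ← Finset.prod_mul_distrib]
  refine Finset.prod_congr rfl fun t _ => ?_
  rw [← Finset.prod_mul_distrib]
  refine Finset.prod_congr rfl fun u _ => ?_
  split_ifs <;> simp

/-- A Markov inequality for the product of the weights of at most `N` rewards. -/
theorem sysExpect_tilt_large (D : Finset I) (j : Fin K) (w : S → ℝ≥0∞) {ψ B : ℝ≥0∞}
    (hψ : 1 ≤ ψ) (hψ' : ψ ≠ ∞) (hw : ∀ u ∈ D, ∑' x, g u j x * w x ≤ ψ)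
    (hB : B ≠ 0) (hB' : B ≠ ∞) (n N : ℕ) :
    sysExpect π g n (fun ω => ind (count D j ω ≤ N ∧ B ≤ tilt D j w ω)) ≤ ψ ^ N / B := by
  have hψ0 : ψ ≠ 0 := (zero_lt_one.trans_le hψ).ne'
  -- Dividing each weight by `ψ` normalises the tilt. Since `1 ≤ ψ`, the factor lost is at most `ψ ^
  -- N` when there are at most `N` plays, so no maximal inequality over the random count is needed.
  have key : ∀ ω : Path I K S n, ind (count D j ω ≤ N ∧ B ≤ tilt D j w ω) ≤
      ψ ^ N / B * tilt D j (fun x => w x * ψ⁻¹) ω := by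
    intro ω
    by_cases h : count D j ω ≤ N ∧ B ≤ tilt D j w ω
    · rw [ind_of h, tilt_mul_const]
      calc (1 : ℝ≥0∞) = ψ ^ count D j ω / B * (B * ψ⁻¹ ^ count D j ω) := by
            rw [div_eq_mul_inv, mul_assoc, ← mul_assoc B⁻¹, ENNReal.inv_mul_cancel hB hB', one_mul,
              ← ENNReal.inv_pow, ENNReal.mul_inv_cancel (pow_ne_zero _ hψ0)
              (ENNReal.pow_ne_top hψ')]
        _ ≤ _ := by
          gcongr
          · exact h.1
          · exact h.2
    · rw [ind_of_not h]; exact zero_le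
  refine (sysExpect_mono π g key).trans ?_
  rw [sysExpect_const_mul]
  refine mul_le_of_le_one_right' (sysExpect_tilt_le_one π g D j _ (fun u hu => ?_) n)
  simp only [← mul_assoc, ENNReal.tsum_mul_right]
  rw [← div_eq_mul_inv]
  exact ENNReal.div_le_of_le_mul (by simpa using hw u hu)

end System

/-! ### Log-likelihood ratios -/

section LogRatio

variable {S : Set ℝ}

/-- The log-likelihood ratio of two distributions at a point. -/
def logRatio (p p' : PMF S) (x : S) : ℝ := Real.log ((p x).toReal / (p' x).toReal)

theorem pmf_toReal_pos {p : PMF S} (hp : ∀ x, p x ≠ 0) (x : S) : 0 < (p x).toReal :=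
  ENNReal.toReal_pos (hp x) (p.apply_ne_top x)

theorem ofReal_exp_logRatio {p p' : PMF S} (hp : ∀ x, p x ≠ 0) (hp' : ∀ x, p' x ≠ 0) (x : S) :
    ENNReal.ofReal (Real.exp (logRatio p p' x)) = p x / p' x := by
  rw [logRatio, Real.exp_log (div_pos (pmf_toReal_pos hp x) (pmf_toReal_pos hp' x)),
    ENNReal.ofReal_div_of_pos (pmf_toReal_pos hp' x), ENNReal.ofReal_toReal (p.apply_ne_top x),
    ENNReal.ofReal_toReal (p'.apply_ne_top x)]

theorem hasSum_toReal (p : PMF S) : HasSum (fun x => (p x).toReal) 1 := by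
  have h := ENNReal.hasSum_toReal (f := fun x => p x) (by rw [p.tsum_coe]; exact ENNReal.one_ne_top)
  rwa [← ENNReal.tsum_toReal_eq p.apply_ne_top, p.tsum_coe, ENNReal.toReal_one] at h

/-- Turns the divergence into the mean of the log-likelihood ratio, the form that the weak law uses.
-/
theorem hasSum_logRatio {p p' : PMF S} (hp : ∀ x, p x ≠ 0) (hp' : ∀ x, p' x ≠ 0)
    (hkl : InformationTheory.klDiv p.toMeasure p'.toMeasure ≠ ∞) :
    HasSum (fun x => (p x).toReal * logRatio p p' x)
      (InformationTheory.klDiv p.toMeasure p'.toMeasure).toReal := by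
  -- A discrete distribution has countable support, and here the support is everything.
  have hcount : Countable S := by
    have := p.support_countable
    have h2 : p.support = Set.univ := Set.eq_univ_of_forall fun x => hp x
    rwa [h2, Set.countable_univ_iff] at this
  obtain ⟨hac, hint⟩ := InformationTheory.klDiv_ne_top_iff.mp hkl
  -- At an atom the Radon–Nikodym derivative is the quotient of the masses, so the equality holds
  -- everywhere and not only almost everywhere.
  have hllr : llr p.toMeasure p'.toMeasure = logRatio p p' := by
    funext x
    have h1 : p.toMeasure {x} = (p.toMeasure.rnDeriv p'.toMeasure x) * p'.toMeasure {x} := by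
      conv_lhs => rw [← Measure.withDensity_rnDeriv_eq _ _ hac]
      rw [withDensity_apply _ (measurableSet_singleton x), lintegral_singleton]
    rw [PMF.toMeasure_apply_singleton _ _ (measurableSet_singleton x),
      PMF.toMeasure_apply_singleton _ _ (measurableSet_singleton x)] at h1
    rw [llr, logRatio, h1, ENNReal.toReal_mul, mul_div_cancel_right₀]
    exact (pmf_toReal_pos hp' x).ne'
  rw [InformationTheory.toReal_klDiv_of_measure_eq hac (by simp), PMF.integral_eq_tsum _ _ hint, hllr]
  simp only [smul_eq_mul]
  refine Summable.hasSum ?_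
  rw [hllr] at hint
  have h2 := hint.hasFiniteIntegral
  rw [HasFiniteIntegral, lintegral_countable'] at h2
  refine Summable.of_norm ?_
  have h3 := ENNReal.summable_toReal h2.ne
  refine h3.congr fun x => ?_
  rw [PMF.toMeasure_apply_singleton _ _ (measurableSet_singleton x), ENNReal.toReal_mul,
    toReal_enorm, norm_mul, mul_comm, Real.norm_of_nonneg ENNReal.toReal_nonneg]

end LogRatio

/-! ### Weak law for the rewards of one arm, and change of measure -/

section Deviation

variable {I : Type*} [Fintype I] {K : ℕ} {S : Set ℝ}

open Classical in
/-- Sum of the values `y` of the rewards that the learners in `D` receive from arm `j`. -/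
def armSum (D : Finset I) (j : Fin K) (y : S → ℝ) {n : ℕ} (ω : Path I K S n) : ℝ :=
  ∑ t, ∑ u, if u ∈ D ∧ (ω t u).1 = j then y (ω t u).2 else 0

theorem armSum_add (D : Finset I) (j : Fin K) (y z : S → ℝ) {n : ℕ} (ω : Path I K S n) :
    armSum D j (fun x => y x + z x) ω = armSum D j y ω + armSum D j z ω := by
  classical
  simp only [armSum, ← Finset.sum_add_distrib]
  refine Finset.sum_congr rfl fun t _ => Finset.sum_congr rfl fun u _ => ?_
  split_ifs <;> simp

theorem armSum_mul (D : Finset I) (j : Fin K) (c : ℝ) (y : S → ℝ) {n : ℕ} (ω : Path I K S n) :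
    armSum D j (fun x => c * y x) ω = c * armSum D j y ω := by
  classical
  simp only [armSum, Finset.mul_sum]
  refine Finset.sum_congr rfl fun t _ => Finset.sum_congr rfl fun u _ => ?_
  split_ifs <;> simp

theorem armSum_mono (D : Finset I) (j : Fin K) {y z : S → ℝ} (h : ∀ x, y x ≤ z x) {n : ℕ}
    (ω : Path I K S n) : armSum D j y ω ≤ armSum D j z ω := by
  classical
  refine Finset.sum_le_sum fun t _ => Finset.sum_le_sum fun u _ => ?_
  split_ifs
  · exact h _
  · exact le_rfl

theorem tilt_exp (D : Finset I) (j : Fin K) (y : S → ℝ) {n : ℕ} (ω : Path I K S n) :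
    tilt D j (fun x => ENNReal.ofReal (Real.exp (y x))) ω =
      ENNReal.ofReal (Real.exp (armSum D j y ω)) := by
  classical
  rw [armSum, Real.exp_sum, ENNReal.ofReal_prod_of_nonneg fun _ _ => (Real.exp_pos _).le, tilt]
  refine Finset.prod_congr rfl fun t _ => ?_
  rw [Real.exp_sum, ENNReal.ofReal_prod_of_nonneg fun _ _ => (Real.exp_pos _).le]
  refine Finset.prod_congr rfl fun u _ => ?_
  split_ifs <;> simp

theorem one_add_sum_le_prod_one_add {ι : Type*} (s : Finset ι) (a : ι → ℝ≥0∞) :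
    1 + ∑ i ∈ s, a i ≤ ∏ i ∈ s, (1 + a i) := by
  classical
  induction s using Finset.induction_on with
  | empty => simp
  | insert i s hi ih =>
    rw [Finset.sum_insert hi, Finset.prod_insert hi]
    calc 1 + (a i + ∑ i ∈ s, a i) ≤ (1 + ∑ i ∈ s, a i) + a i * (1 + ∑ i ∈ s, a i) := by
          rw [mul_add, mul_one, add_comm (a i), ← add_assoc, ← add_assoc]; exact le_self_add
      _ = (1 + a i) * (1 + ∑ i ∈ s, a i) := by ring
      _ ≤ _ := mul_le_mul_right ih _

/-- Bounding a sum by a product lets the supermartingale bound for tilts serve as a first-moment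
Markov inequality. -/
theorem ofReal_armSum_le_tilt (D : Finset I) (j : Fin K) {y : S → ℝ} (hy : ∀ x, 0 ≤ y x) {n : ℕ}
    (ω : Path I K S n) :
    ENNReal.ofReal (armSum D j y ω) ≤ tilt D j (fun x => 1 + ENNReal.ofReal (y x)) ω := by
  classical
  have h0 : ∀ t u, (0 : ℝ) ≤ if u ∈ D ∧ (ω t u).1 = j then y (ω t u).2 else 0 := by
    intro t u
    split_ifs
    · exact hy _
    · exact le_rfl
  rw [armSum, ENNReal.ofReal_sum_of_nonneg fun t _ => Finset.sum_nonneg fun u _ => h0 t u]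
  refine le_trans (le_trans le_add_self (one_add_sum_le_prod_one_add _ _)) ?_
  refine Finset.prod_le_prod' fun t _ => ?_
  rw [ENNReal.ofReal_sum_of_nonneg fun u _ => h0 t u]
  refine (one_add_sum_le_prod_one_add _ _).trans (Finset.prod_le_prod' fun u _ => ?_)
  split_ifs <;> simp

variable (π : SysPolicy I K S)

/-- Chernoff bound for the sum of a finitely supported function of at most `N` rewards. -/
theorem chernoff_arm {p : PMF S} {Y : S → ℝ} {s₀ : Finset S} {m ε : ℝ} (hε : 0 < ε) (hm0 : 0 ≤ m)
    (hm : ∑ x ∈ s₀, (p x).toReal * Y x ≤ m) :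
    ∃ c : ℝ, 0 < c ∧ ∀ (g : I → Fin K → PMF S) (D : Finset I) (j : Fin K),
      (∀ u ∈ D, g u j = p) → ∀ n N : ℕ,
      sysExpect π g n (fun ω => ind (count D j ω ≤ N ∧
        (m + ε) * N ≤ armSum D j ((s₀ : Set S).indicator Y) ω)) ≤
          ENNReal.ofReal (Real.exp (-(c * N))) := by
  classical
  set B : ℝ := 1 + ∑ x ∈ s₀, |Y x| with hB
  have hB1 : 1 ≤ B := le_add_of_nonneg_right (Finset.sum_nonneg fun _ _ => abs_nonneg _)
  have hB0 : 0 < B := zero_lt_one.trans_le hB1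
  have hYB : ∀ x ∈ s₀, |Y x| ≤ B := fun x hx =>
    (Finset.single_le_sum (f := fun x => |Y x|) (fun _ _ => abs_nonneg _) hx).trans
      (le_add_of_nonneg_left zero_le_one)
  -- The exponential parameter is small enough for `exp y ≤ 1 + y + y ^ 2` at `y = s * Y x`, and for
  -- the quadratic term `s ^ 2 * B ^ 2` to use up at most half of the gain `s * ε`.
  set s : ℝ := min 1 ε / (2 * B ^ 2) with hs
  have hs0 : 0 < s := by positivity
  have hsB2 : s * B ^ 2 ≤ ε / 2 := by
    have : s * B ^ 2 = min 1 ε / 2 := by rw [hs]; field_simp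
    rw [this]; linarith [min_le_right 1 ε]
  have hsB : s * B ≤ 1 := by
    have h1 : s * B ^ 2 ≤ 1 / 2 := by
      have : s * B ^ 2 = min 1 ε / 2 := by rw [hs]; field_simp
      rw [this]; linarith [min_le_left 1 ε]
    nlinarith [mul_pos hs0 hB0]
  set W : S → ℝ := (s₀ : Set S).indicator Y with hW
  set ψ : ℝ := Real.exp (s * m + s ^ 2 * B ^ 2) with hψ
  have hψ1 : 1 ≤ ψ := Real.one_le_exp (by positivity)
  have hsum : HasSum (fun x => (p x).toReal * Real.exp (s * W x))
      (1 + ∑ x ∈ s₀, (p x).toReal * (Real.exp (s * Y x) - 1)) := by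
    have h2 : HasSum (fun x => (p x).toReal * (Real.exp (s * W x) - 1))
        (∑ x ∈ s₀, (p x).toReal * (Real.exp (s * Y x) - 1)) := by
      have h3 : ∑ x ∈ s₀, (p x).toReal * (Real.exp (s * Y x) - 1) =
          ∑ x ∈ s₀, (p x).toReal * (Real.exp (s * W x) - 1) :=
        Finset.sum_congr rfl fun x hx => by
          rw [hW, Set.indicator_of_mem (Finset.mem_coe.mpr hx)]
      rw [h3]
      refine hasSum_sum_of_ne_finset_zero fun x hx => ?_
      rw [hW, Set.indicator_of_notMem (by simpa using hx)]
      simp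
    convert (hasSum_toReal p).add h2 using 2
    ring
  have hle : 1 + ∑ x ∈ s₀, (p x).toReal * (Real.exp (s * Y x) - 1) ≤ ψ := by
    have h1 : ∑ x ∈ s₀, (p x).toReal * (Real.exp (s * Y x) - 1) ≤
        ∑ x ∈ s₀, (s * ((p x).toReal * Y x) + s ^ 2 * B ^ 2 * (p x).toReal) := by
      refine Finset.sum_le_sum fun x hx => ?_
      have h2 : |s * Y x| ≤ s * B := by
        rw [abs_mul, abs_of_pos hs0]
        exact mul_le_mul_of_nonneg_left (hYB x hx) hs0.le
      have h3 := (abs_le.mp (Real.abs_exp_sub_one_sub_id_le (h2.trans hsB))).2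
      have h4 : (s * Y x) ^ 2 ≤ s ^ 2 * B ^ 2 := by
        rw [← mul_pow]; exact sq_le_sq.mpr (h2.trans (le_abs_self _))
      have h5 : Real.exp (s * Y x) - 1 ≤ s * Y x + s ^ 2 * B ^ 2 := by linarith
      have := mul_le_mul_of_nonneg_left h5 (ENNReal.toReal_nonneg (a := p x))
      linarith
    rw [Finset.sum_add_distrib, ← Finset.mul_sum, ← Finset.mul_sum] at h1
    have h2 : ∑ x ∈ s₀, (p x).toReal ≤ 1 :=
      sum_le_hasSum s₀ (fun _ _ => ENNReal.toReal_nonneg) (hasSum_toReal p)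
    have h3 := Real.add_one_le_exp (s * m + s ^ 2 * B ^ 2)
    have h4 := mul_le_mul_of_nonneg_left hm hs0.le
    have h5 := mul_le_mul_of_nonneg_left h2 (by positivity : 0 ≤ s ^ 2 * B ^ 2)
    linarith
  refine ⟨s * ε / 2, by positivity, fun g D j hg n N => ?_⟩
  have hw : ∀ u ∈ D, ∑' x, g u j x * ENNReal.ofReal (Real.exp (s * W x)) ≤ ENNReal.ofReal ψ := by
    intro u hu
    rw [hg u hu]
    calc ∑' x, p x * ENNReal.ofReal (Real.exp (s * W x))
        = ∑' x, ENNReal.ofReal ((p x).toReal * Real.exp (s * W x)) := tsum_congr fun x => by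
          rw [ENNReal.ofReal_mul ENNReal.toReal_nonneg, ENNReal.ofReal_toReal (p.apply_ne_top x)]
      _ = ENNReal.ofReal (1 + ∑ x ∈ s₀, (p x).toReal * (Real.exp (s * Y x) - 1)) := by
          rw [← ENNReal.ofReal_tsum_of_nonneg (fun x => by positivity) hsum.summable, hsum.tsum_eq]
      _ ≤ _ := ENNReal.ofReal_le_ofReal hle
  have hmk := sysExpect_tilt_large π g D j _ (ψ := ENNReal.ofReal ψ)
    (B := ENNReal.ofReal (Real.exp (s * ((m + ε) * N)))) (by simpa using hψ1)
    ENNReal.ofReal_ne_top hw (by simpa using Real.exp_pos _) ENNReal.ofReal_ne_top n N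
  refine (sysExpect_mono π g fun ω => ?_).trans (hmk.trans ?_)
  · by_cases h : count D j ω ≤ N ∧ (m + ε) * N ≤ armSum D j W ω
    · rw [ind_of h, ind_of]
      refine ⟨h.1, ?_⟩
      rw [tilt_exp D j (fun x => s * W x), armSum_mul]
      exact ENNReal.ofReal_le_ofReal
        (Real.exp_le_exp.mpr (mul_le_mul_of_nonneg_left h.2 hs0.le))
    · rw [ind_of_not h]; exact zero_le
  · rw [← ENNReal.ofReal_pow (by positivity), ← ENNReal.ofReal_div_of_pos (Real.exp_pos _), hψ,
      ← Real.exp_nat_mul, ← Real.exp_sub]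
    refine ENNReal.ofReal_le_ofReal (Real.exp_le_exp.mpr ?_)
    have := mul_le_mul_of_nonneg_left hsB2 (mul_nonneg hs0.le N.cast_nonneg)
    nlinarith

/-- Markov bound for the sum of a non-negative function with small mean of at most `N` rewards. -/
theorem markov_arm {p : PMF S} {R : S → ℝ} (hR : ∀ x, 0 ≤ R x) {ε c : ℝ} (hε : 0 < ε)
    (hc : 0 < c) (hmean : ∑' x, p x * ENNReal.ofReal (R x) ≤ ENNReal.ofReal c⁻¹)
    (g : I → Fin K → PMF S) (D : Finset I) (j : Fin K) (hg : ∀ u ∈ D, g u j = p) (n : ℕ) {N : ℕ}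
    (hN : 0 < N) :
    sysExpect π g n (fun ω => ind (count D j ω ≤ N ∧ ε * N ≤ armSum D j R ω)) ≤
      ENNReal.ofReal (Real.exp 1 / (c * ε)) := by
  have hN' : (0 : ℝ) < N := Nat.cast_pos.mpr hN
  -- The scale `c / N` makes each weight have mean at most `1 + 1 / N ≤ exp (1 / N)`, so that `N`
  -- plays cost only the constant factor `exp 1`.
  have hw : ∀ u ∈ D, ∑' x, g u j x * (1 + ENNReal.ofReal (c / N * R x)) ≤
      ENNReal.ofReal (Real.exp (1 / N)) := by
    intro u hu
    rw [hg u hu]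
    simp only [mul_add, mul_one, ENNReal.tsum_add, p.tsum_coe]
    have h1 : ∑' x, p x * ENNReal.ofReal (c / N * R x) ≤ ENNReal.ofReal (1 / N) := by
      simp only [ENNReal.ofReal_mul (by positivity : 0 ≤ c / N), mul_left_comm (p _),
        ENNReal.tsum_mul_left]
      refine (mul_le_mul_right hmean _).trans ?_
      rw [← ENNReal.ofReal_mul (by positivity)]
      exact ENNReal.ofReal_le_ofReal (by field_simp; exact le_rfl)
    refine (add_le_add_right h1 1).trans ?_
    rw [← ENNReal.ofReal_one, ← ENNReal.ofReal_add zero_le_one (by positivity)]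
    exact ENNReal.ofReal_le_ofReal (by linarith [Real.add_one_le_exp (1 / (N : ℝ))])
  have hmk := sysExpect_tilt_large π g D j _ (ψ := ENNReal.ofReal (Real.exp (1 / N)))
    (B := ENNReal.ofReal (c * ε)) (by simp)
    ENNReal.ofReal_ne_top hw (by simpa using mul_pos hc hε) ENNReal.ofReal_ne_top n N
  refine (sysExpect_mono π g fun ω => ?_).trans (hmk.trans ?_)
  · by_cases h : count D j ω ≤ N ∧ ε * N ≤ armSum D j R ω
    · rw [ind_of h, ind_of]
      refine ⟨h.1, le_trans ?_ (ofReal_armSum_le_tilt D j (fun x => by have := hR x; positivity) ω)⟩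
      rw [armSum_mul]
      refine ENNReal.ofReal_le_ofReal ?_
      calc c * ε = c / N * (ε * N) := by field_simp
        _ ≤ _ := mul_le_mul_of_nonneg_left h.2 (by positivity)
    · rw [ind_of_not h]; exact zero_le
  · rw [← ENNReal.ofReal_pow (by positivity), ← ENNReal.ofReal_div_of_pos (by positivity),
      ← Real.exp_nat_mul, mul_one_div_cancel hN'.ne']

/-- A weak law of large numbers, uniform over all systems of learners: the sum of at most `N`
rewards rarely exceeds `β N` when `β` is larger than the mean. -/
theorem weak_law_arm {p : PMF S} {Y : S → ℝ} {κ β : ℝ} (hκ : 0 ≤ κ) (hβ : κ < β)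
    (hY : HasSum (fun x => (p x).toReal * Y x) κ) {η : ℝ} (hη : 0 < η) :
    ∃ N₀ : ℕ, ∀ (g : I → Fin K → PMF S) (D : Finset I) (j : Fin K),
      (∀ u ∈ D, g u j = p) → ∀ n N : ℕ, N₀ ≤ N →
      sysExpect π g n (fun ω => ind (count D j ω ≤ N ∧ β * N ≤ armSum D j Y ω)) ≤
        ENNReal.ofReal η := by
  -- One third of the gap pays for the mean of the truncated function, one for its Chernoff
  -- deviation, one for the tail outside the finite set.
  set ε : ℝ := (β - κ) / 3 with hε'
  have hε : 0 < ε := by rw [hε']; linarith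
  -- Chosen so that the Markov bound `exp 1 / (c * ε)` for the tail equals `η / 2`.
  set c : ℝ := 2 * Real.exp 1 / (ε * η) with hc'
  have hc : 0 < c := by positivity
  have hfin : ∑' x, ENNReal.ofReal ((p x).toReal * |Y x|) ≠ ∞ := by
    refine (hY.summable.abs.congr fun x => ?_).tsum_ofReal_ne_top
    rw [abs_mul, abs_of_nonneg ENNReal.toReal_nonneg]
  have e1 : ∀ᶠ s₀ : Finset S in atTop, ∑ x ∈ s₀, (p x).toReal * Y x ≤ κ + ε :=
    (hY.eventually_lt_const (by linarith)).mono fun _ h => h.le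
  have e2 : ∀ᶠ s₀ : Finset S in atTop,
      ∑' x : {x // x ∉ s₀}, ENNReal.ofReal ((p x).toReal * |Y x|) < ENNReal.ofReal c⁻¹ :=
    (ENNReal.tendsto_tsum_compl_atTop_zero hfin).eventually_lt_const (by simpa using hc)
  obtain ⟨s₀, h1, h2⟩ := (e1.and e2).exists
  obtain ⟨d, hd, hch⟩ := chernoff_arm π (I := I) (K := K) hε (by positivity : 0 ≤ κ + ε) h1
  have e3 : ∀ᶠ N : ℕ in atTop, Real.exp (-(d * N)) < η / 2 := by
    refine Tendsto.eventually_lt_const (by positivity) ?_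
    refine Real.tendsto_exp_neg_atTop_nhds_zero.comp ?_
    exact tendsto_natCast_atTop_atTop.const_mul_atTop hd
  obtain ⟨N₀, hN₀⟩ := eventually_atTop.mp (e3.and (eventually_gt_atTop 0))
  refine ⟨N₀, fun g D j hg n N hN => ?_⟩
  obtain ⟨hN1, hN2⟩ := hN₀ N hN
  set R : S → ℝ := ((s₀ : Set S)ᶜ).indicator fun x => |Y x| with hRd
  have hR : ∀ x, 0 ≤ R x := fun x => Set.indicator_nonneg (fun _ _ => abs_nonneg _) x
  have hYWR : ∀ x, Y x ≤ (s₀ : Set S).indicator Y x + R x := by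
    intro x
    by_cases hx : x ∈ (s₀ : Set S)
    · rw [Set.indicator_of_mem hx]; linarith [hR x]
    · rw [Set.indicator_of_notMem hx, hRd, Set.indicator_of_mem (by exact hx), zero_add]
      exact le_abs_self _
  have hRm : ∑' x, p x * ENNReal.ofReal (R x) ≤ ENNReal.ofReal c⁻¹ := by
    refine le_trans (le_of_eq ?_) h2.le
    have h3 : (fun x => p x * ENNReal.ofReal (R x)) = ({x | x ∉ s₀} : Set S).indicator
        fun x => ENNReal.ofReal ((p x).toReal * |Y x|) := by
      funext x
      by_cases hx : x ∈ s₀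
      · rw [hRd, Set.indicator_of_notMem (by simpa using hx),
          Set.indicator_of_notMem (by simpa using hx)]
        simp
      · rw [hRd, Set.indicator_of_mem (by simpa using hx), Set.indicator_of_mem (by simpa using hx),
          ENNReal.ofReal_mul ENNReal.toReal_nonneg, ENNReal.ofReal_toReal (p.apply_ne_top x)]
    rw [h3]
    exact (tsum_subtype {x : S | x ∉ s₀} _).symm
  have hmk := markov_arm π hR hε hc hRm g D j hg n hN2
  have hsplit : ∀ ω : Path I K S n, ind (count D j ω ≤ N ∧ β * N ≤ armSum D j Y ω) ≤
      ind (count D j ω ≤ N ∧ (κ + ε + ε) * N ≤ armSum D j ((s₀ : Set S).indicator Y) ω) +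
        ind (count D j ω ≤ N ∧ ε * N ≤ armSum D j R ω) := by
    intro ω
    by_cases h : count D j ω ≤ N ∧ β * N ≤ armSum D j Y ω
    · have h3 := h.2.trans (armSum_mono D j hYWR ω)
      rw [armSum_add D j ((s₀ : Set S).indicator Y) R] at h3
      rw [ind_of h]
      by_cases h4 : ε * N ≤ armSum D j R ω
      · rw [ind_of (p := _ ∧ ε * N ≤ armSum D j R ω) ⟨h.1, h4⟩]; exact le_add_self
      · rw [ind_of (p := _ ∧ (κ + ε + ε) * N ≤ _) ⟨h.1, ?_⟩]
        · exact le_self_add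
        · have : β = κ + ε + ε + ε := by rw [hε']; ring
          rw [this] at h3
          push Not at h4
          linarith
    · rw [ind_of_not h]; exact zero_le
  refine (sysExpect_mono π g hsplit).trans ?_
  rw [sysExpect_add]
  refine (add_le_add (hch g D j hg n N) hmk).trans ?_
  rw [← ENNReal.ofReal_add (by positivity) (by positivity)]
  refine ENNReal.ofReal_le_ofReal ?_
  have h5 : Real.exp 1 / (c * ε) = η / 2 := by rw [hc']; field_simp
  linarith

/-- Changing the reward distribution of arm `j` at the learners in `D` from `p'` to `p` multiplies
the probability of a path by its likelihood ratio. -/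
theorem sysProb_change {p p' : PMF S} (hp' : ∀ x, p' x ≠ 0)
    {g g' : I → Fin K → PMF S} {D : Finset I} {j : Fin K} (hg : ∀ u ∈ D, g u j = p)
    (hg' : ∀ u ∈ D, g' u j = p') (hgg' : ∀ u a, ¬(u ∈ D ∧ a = j) → g u a = g' u a) {n : ℕ}
    (ω : Path I K S n) :
    sysProb π g ω = sysProb π g' ω * tilt D j (fun x => p x / p' x) ω := by
  classical
  simp only [sysProb, tilt, ← Finset.prod_mul_distrib]
  refine Finset.prod_congr rfl fun t _ => Finset.prod_congr rfl fun u _ => ?_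
  by_cases h : u ∈ D ∧ (ω t u).1 = j
  · rw [if_pos h, h.2, hg u h.1, hg' u h.1, mul_assoc,
      ENNReal.mul_div_cancel (hp' _) (p'.apply_ne_top _)]
  · rw [if_neg h, mul_one, hgg' u _ h]

/-- Either the log-likelihood ratio is below `β * N`, and the change of measure costs at most `exp
(β * N)`, or the path lies in the exceptional event of the weak law, which costs `η`. -/
theorem sysExpect_change {p p' : PMF S} (hp : ∀ x, p x ≠ 0) (hp' : ∀ x, p' x ≠ 0) {κ β : ℝ}
    (hκ : 0 ≤ κ) (hβ : κ < β) (hY : HasSum (fun x => (p x).toReal * logRatio p p' x) κ)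
    {η : ℝ} (hη : 0 < η) :
    ∃ N₀ : ℕ, ∀ (g g' : I → Fin K → PMF S) (D : Finset I) (j : Fin K), (∀ u ∈ D, g u j = p) →
      (∀ u ∈ D, g' u j = p') → (∀ u a, ¬(u ∈ D ∧ a = j) → g u a = g' u a) →
      ∀ n N : ℕ, N₀ ≤ N →
      sysExpect π g n (fun ω => ind (count D j ω ≤ N)) ≤
        ENNReal.ofReal (Real.exp (β * N)) * sysExpect π g' n (fun ω => ind (count D j ω ≤ N)) +
          ENNReal.ofReal η := by
  obtain ⟨N₀, h⟩ := weak_law_arm π (I := I) (K := K) hκ hβ hY hη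
  refine ⟨N₀, fun g g' D j hg hg' hgg' n N hN => ?_⟩
  refine le_trans ?_ (add_le_add_right (h g D j hg n N hN) _)
  rw [← sysExpect_const_mul, sysExpect, sysExpect, sysExpect, ← ENNReal.tsum_add]
  refine ENNReal.tsum_le_tsum fun ω => ?_
  by_cases hc : count D j ω ≤ N
  · by_cases hL : β * N ≤ armSum D j (logRatio p p') ω
    · rw [ind_of (p := _ ∧ _) ⟨hc, hL⟩, ind_of hc]
      exact le_add_self
    · refine le_trans ?_ le_self_add
      rw [ind_of hc, mul_one, mul_one, sysProb_change π hp' hg hg' hgg']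
      refine mul_le_mul_right ?_ _
      simp only [← ofReal_exp_logRatio hp hp']
      rw [tilt_exp]
      exact ENNReal.ofReal_le_ofReal (Real.exp_le_exp.mpr (not_le.mp hL).le)
  · rw [ind_of_not hc]; simp

end Deviation

/-! ### From rare plays of the other arms to logarithmic lower bounds -/

section LowerBound

variable {I : Type*} [Fintype I] {K : ℕ} {S : Set ℝ}

theorem sum_pulls {V : Type*} (u : V) {n : ℕ} (ω : Path V K S n) : ∑ i, pulls i u ω = n := by
  classical
  have := Finset.card_eq_sum_card_fiberwise (s := (Finset.univ : Finset (Fin n)))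
    (t := (Finset.univ : Finset (Fin K))) (f := fun t => (ω t u).1) (fun _ _ => Finset.mem_univ _)
  simpa [pulls] using this.symm

theorem le_sum_other_pulls {V : Type*} (D : Finset V) (j : Fin K) {v : V} (hv : v ∈ D) {n N : ℕ}
    (ω : Path V K S n) (h : count D j ω ≤ N) :
    n ≤ N + ∑ i ∈ Finset.univ.erase j, pulls i v ω := by
  have h1 : pulls j v ω ≤ count D j ω :=
    Finset.single_le_sum (f := fun u => pulls j u ω) (fun _ _ => Nat.zero_le _) hv
  have h2 := Finset.add_sum_erase Finset.univ (fun i => pulls i v ω) (Finset.mem_univ j)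
  rw [sum_pulls] at h2
  omega

/-- If a learner in `D` plays the arms other than `j` rarely when `j` has reward distribution `p'`
at the learners in `D`, then under `p` these learners play `j` at least `q log n` times with
probability tending to one, for every `q` with `q * KL(p ‖ p') < 1`. -/
theorem tendsto_count_lt (π : SysPolicy I K S) {p p' : PMF S} (hp : ∀ x, p x ≠ 0)
    (hp' : ∀ x, p' x ≠ 0) {κ q : ℝ} (hκ : 0 ≤ κ)
    (hY : HasSum (fun x => (p x).toReal * logRatio p p' x) κ) (hq : 0 < q) (hqκ : q * κ < 1)
    (g g' : I → Fin K → PMF S) (D : Finset I) (j : Fin K) (hg : ∀ u ∈ D, g u j = p)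
    (hg' : ∀ u ∈ D, g' u j = p') (hgg' : ∀ u a, ¬(u ∈ D ∧ a = j) → g u a = g' u a)
    {v : I} (hv : v ∈ D)
    (hcons : ∀ a : ℝ, 0 < a → ∀ i ≠ j, ∀ᶠ n : ℕ in atTop,
      sysExpect π g' n (fun ω => (pulls i v ω : ℝ≥0∞)) ≤ ENNReal.ofReal ((n : ℝ) ^ a)) :
    Tendsto (fun n : ℕ => sysExpect π g n fun ω => ind ((count D j ω : ℝ) < q * Real.log n)) atTop
      (𝓝 0) := by
  rw [ENNReal.tendsto_nhds_zero]
  intro ε hε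
  obtain ⟨r, hr0, hrε⟩ := ENNReal.lt_iff_exists_nnreal_btwn.mp hε
  have hr : (0 : ℝ) < r := by exact_mod_cast hr0
  -- Any value strictly between `κ` and `1 / q` would do: above `κ` for the weak law, below `1 / q`
  -- so that `n ^ (q * β)` is of smaller order than `n`.
  set β : ℝ := (κ + 1 / q) / 2 with hβd
  have hκq : κ < 1 / q := by rw [lt_div_iff₀ hq]; linarith
  have hβ : κ < β := by rw [hβd]; linarith
  have hβ0 : 0 ≤ β := hκ.trans hβ.le
  have hqβ : q * β < 1 := by
    have : β < 1 / q := by rw [hβd]; linarith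
    rw [lt_div_iff₀ hq] at this
    linarith
  -- With this exponent the final bound has order `n ^ (q * β) * n ^ (a - 1) = n ^ (-a)`.
  set a : ℝ := (1 - q * β) / 2 with had
  have ha : 0 < a := by rw [had]; linarith
  obtain ⟨N₀, hN₀⟩ := sysExpect_change π hp hp' hκ hβ hY (half_pos hr)
  have hlog : Tendsto (fun n : ℕ => q * Real.log n) atTop atTop :=
    (Real.tendsto_log_atTop.comp tendsto_natCast_atTop_atTop).const_mul_atTop hq
  have ev1 : ∀ᶠ n : ℕ in atTop, N₀ ≤ ⌊q * Real.log n⌋₊ :=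
    (tendsto_nat_floor_atTop.comp hlog).eventually_ge_atTop N₀
  have ev2 : ∀ᶠ n : ℕ in atTop, q * Real.log n ≤ n / 2 := by
    have h := (Real.isLittleO_log_id_atTop.comp_tendsto tendsto_natCast_atTop_atTop).def
      (c := 1 / (2 * q)) (by positivity)
    filter_upwards [h, eventually_ge_atTop 1] with n hn hn1
    simp only [Function.comp, id, Real.norm_eq_abs, Nat.abs_cast] at hn
    have h2 := mul_le_mul_of_nonneg_left ((le_abs_self _).trans hn) hq.le
    calc q * Real.log n ≤ q * (1 / (2 * q) * n) := h2
      _ = n / 2 := by field_simp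
  have ev3 : ∀ᶠ n : ℕ in atTop, ∀ i ∈ Finset.univ.erase j,
      sysExpect π g' n (fun ω => (pulls i v ω : ℝ≥0∞)) ≤ ENNReal.ofReal ((n : ℝ) ^ a) :=
    (Finset.eventually_all _).mpr fun i hi => hcons a ha i (Finset.ne_of_mem_erase hi)
  have ev4 : ∀ᶠ n : ℕ in atTop, 2 * K * (n : ℝ) ^ (-a) < r / 2 := by
    refine Tendsto.eventually_lt_const (half_pos hr) ?_
    simpa using ((tendsto_rpow_neg_atTop ha).comp tendsto_natCast_atTop_atTop).const_mul
      (2 * (K : ℝ))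
  filter_upwards [ev1, ev2, ev3, ev4, eventually_ge_atTop 1] with n h1 h2 h3 h4 hn1
  have hn : (1 : ℝ) ≤ n := by exact_mod_cast hn1
  have hn0 : (0 : ℝ) < n := by linarith
  set N : ℕ := ⌊q * Real.log n⌋₊ with hN
  have hNle : (N : ℝ) ≤ q * Real.log n :=
    Nat.floor_le (mul_nonneg hq.le (Real.log_nonneg hn))
  -- If `D` plays `j` at most `N ≤ n / 2` times, then `v` spends at least `n / 2` rounds on the
  -- other arms; Markov's inequality makes this unlikely under `g'`.
  have hP' : sysExpect π g' n (fun ω => ind (count D j ω ≤ N)) ≤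
      ENNReal.ofReal (2 / n * (K * (n : ℝ) ^ a)) := by
    have hpt : ∀ ω : Path I K S n, ind (count D j ω ≤ N) ≤
        ENNReal.ofReal (2 / n) * ∑ i ∈ Finset.univ.erase j, (pulls i v ω : ℝ≥0∞) := by
      intro ω
      by_cases hc : count D j ω ≤ N
      · have h5 := le_sum_other_pulls D j hv ω hc
        have h6 : (n : ℝ) ≤ N + (∑ i ∈ Finset.univ.erase j, pulls i v ω : ℕ) := by
          exact_mod_cast h5
        rw [ind_of hc, ← Nat.cast_sum, ← ENNReal.ofReal_natCast, ← ENNReal.ofReal_mul (by positivity),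
          ← ENNReal.ofReal_one]
        refine ENNReal.ofReal_le_ofReal ?_
        rw [div_mul_eq_mul_div, le_div_iff₀ hn0]
        linarith
      · rw [ind_of_not hc]; exact zero_le
    refine (sysExpect_mono π g' hpt).trans ?_
    rw [sysExpect_const_mul, sysExpect_sum, ENNReal.ofReal_mul (by positivity)]
    refine mul_le_mul_right ((Finset.sum_le_sum h3).trans ?_) _
    rw [Finset.sum_const, nsmul_eq_mul, ENNReal.ofReal_mul (by positivity), ENNReal.ofReal_natCast]
    refine mul_le_mul_left ?_ _
    exact_mod_cast (Finset.card_erase_le.trans (by simp))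
  have hA : sysExpect π g n (fun ω => ind ((count D j ω : ℝ) < q * Real.log n)) ≤
      sysExpect π g n (fun ω => ind (count D j ω ≤ N)) := by
    refine sysExpect_mono π g fun ω => ?_
    by_cases hc : (count D j ω : ℝ) < q * Real.log n
    · rw [ind_of hc, ind_of (Nat.le_floor hc.le)]
    · rw [ind_of_not hc]; exact zero_le
  refine (hA.trans (hN₀ g g' D j hg hg' hgg' n N h1)).trans (le_trans ?_ hrε.le)
  refine (add_le_add_left (mul_le_mul_right hP' _) _).trans ?_
  rw [← ENNReal.ofReal_mul (Real.exp_pos _).le,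
    ← ENNReal.ofReal_add (by positivity) (by positivity), ← ENNReal.ofReal_coe_nnreal]
  refine ENNReal.ofReal_le_ofReal ?_
  have h5 : Real.exp (β * N) ≤ (n : ℝ) ^ (q * β) := by
    rw [Real.rpow_def_of_pos hn0]
    refine Real.exp_le_exp.mpr ?_
    have := mul_le_mul_of_nonneg_left hNle hβ0
    linarith
  have h6 : (n : ℝ) ^ (q * β) * (2 / n * (K * (n : ℝ) ^ a)) = 2 * K * (n : ℝ) ^ (-a) := by
    have h7 : (n : ℝ) ^ (-a) = (n : ℝ) ^ (q * β) * (n : ℝ) ^ a * (n : ℝ) ^ (-1 : ℝ) := by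
      rw [← Real.rpow_add hn0, ← Real.rpow_add hn0]
      congr 1
      rw [had]; ring
    rw [h7, Real.rpow_neg_one]
    ring
  have h8 := mul_le_mul_of_nonneg_right h5 (by positivity : 0 ≤ 2 / (n : ℝ) * (K * (n : ℝ) ^ a))
  linarith

/-- If `X n` is at least `Q log n` up to an error of smaller order, then `liminf X n / log n` is at
least every `Q' < Q`. -/
theorem le_liminf_div_log {X e : ℕ → ℝ≥0∞} {Q Q' : ℝ} (hQ' : 0 ≤ Q') (hQ : Q' < Q)
    (he : Tendsto e atTop (𝓝 0))
    (h : ∀ᶠ n : ℕ in atTop,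
      ENNReal.ofReal (Q * Real.log n) ≤ X n + e n * ENNReal.ofReal (Real.log n)) :
    ENNReal.ofReal Q' ≤ liminf (fun n : ℕ => X n / ENNReal.ofReal (Real.log n)) atTop := by
  refine le_liminf_of_le (by isBoundedDefault) ?_
  have h1 : ∀ᶠ n in atTop, e n ≤ ENNReal.ofReal (Q - Q') :=
    (he.eventually_lt_const (by simpa using hQ)).mono fun _ h => h.le
  filter_upwards [h, h1, eventually_ge_atTop 2] with n h h1 hn
  have hlog : 0 < Real.log n := Real.log_pos (by exact_mod_cast hn)
  rw [ENNReal.le_div_iff_mul_le (Or.inl (by simpa using hlog)) (Or.inl ENNReal.ofReal_ne_top),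
    ← ENNReal.ofReal_mul hQ']
  have h2 : ENNReal.ofReal (Q * Real.log n) ≤ X n + ENNReal.ofReal ((Q - Q') * Real.log n) := by
    refine h.trans ?_
    rw [ENNReal.ofReal_mul (by linarith)]
    gcongr
  have h3 : Q * Real.log n = Q' * Real.log n + (Q - Q') * Real.log n := by ring
  rw [h3, ENNReal.ofReal_add (by positivity) (mul_nonneg (by linarith) hlog.le)] at h2
  exact (ENNReal.add_le_add_iff_right ENNReal.ofReal_ne_top).mp h2

/-- A count that is at least `Q log n` with probability tending to one is on average at least of
order `Q' log n`, for every `Q' < Q`. -/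
theorem le_liminf_sysExpect (π : SysPolicy I K S) (g : I → Fin K → PMF S)
    (T : (n : ℕ) → Path I K S n → ℕ) {Q Q' : ℝ} (hQ' : 0 ≤ Q') (hQ : Q' < Q)
    (h : Tendsto (fun n : ℕ => sysExpect π g n fun ω => ind ((T n ω : ℝ) < Q * Real.log n)) atTop
      (𝓝 0)) :
    ENNReal.ofReal Q' ≤ liminf (fun n : ℕ => sysExpect π g n (fun ω => (T n ω : ℝ≥0∞)) /
      ENNReal.ofReal (Real.log n)) atTop := by
  have h1 := ENNReal.Tendsto.const_mul (a := ENNReal.ofReal Q) h (Or.inr ENNReal.ofReal_ne_top)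
  rw [mul_zero] at h1
  refine le_liminf_div_log hQ' hQ h1 (Eventually.of_forall fun n => ?_)
  rw [mul_right_comm, ← ENNReal.ofReal_mul (hQ'.trans hQ.le), ← sysExpect_const_mul,
    ← sysExpect_add, ← sysExpect_const π g n (ENNReal.ofReal (Q * Real.log n))]
  refine sysExpect_mono π g fun ω => ?_
  rw [sysExpect_const]
  by_cases hc : (T n ω : ℝ) < Q * Real.log n
  · rw [ind_of hc, mul_one]; exact le_add_self
  · refine le_trans ?_ le_self_add
    rw [← ENNReal.ofReal_natCast]
    exact ENNReal.ofReal_le_ofReal (not_lt.mp hc)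

end LowerBound

section Network

variable {V : Type*} [Fintype V] {G : SimpleGraph V} {K : ℕ} {S : Set ℝ} {Θ : Type*}

theorem mem_nbhd_self (G : SimpleGraph V) (v : V) : v ∈ nbhd G v := by simp [nbhd]

/-! ### The network as a system of learners -/

/-- The policies of the network, as policies with full information. -/
def netPolicy (Φ : (v : V) → Policy G K S v) : SysPolicy V K S :=
  fun t h u => Φ u t fun s w => h s w

theorem expect_eq_sysExpect (f : Θ → PMF S) (Φ : (v : V) → Policy G K S v) (θ : Fin K → Θ) (n : ℕ)
    (F : Path V K S n → ℝ≥0∞) :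
    expect f Φ θ n F = sysExpect (netPolicy Φ) (fun _ a => f (θ a)) n F := rfl

open Classical in
/-- The policies of the nodes of `𝒩(v)` when the trajectory of the other nodes is `b`. -/
def condPolicy (Φ : (v : V) → Policy G K S v) (v : V) (b : OutsidePath G K S v) :
    SysPolicy {u // u ∈ nbhd G v} K S :=
  fun t h u => Φ u t fun s w => if hw : (w : V) ∈ nbhd G v then h s ⟨w, hw⟩ else b s ⟨w, hw⟩

theorem glue_apply {v : V} (b : OutsidePath G K S v) {n : ℕ}
    (x : Fin n → {u // u ∈ nbhd G v} → Fin K × S) (t : Fin n) (u : {u // u ∈ nbhd G v}) :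
    glue b x t u = x t u := by
  simp [glue, u.2]

/-- Fixing the outside trajectory leaves an autonomous system whose learners are the nodes of
`𝒩(v)`, the trajectory being absorbed into their policies. -/
theorem condExpect_eq_sysExpect (f : Θ → PMF S) (Φ : (v : V) → Policy G K S v) (θ : Fin K → Θ)
    (v : V) (b : OutsidePath G K S v) (n : ℕ) (F : Path V K S n → ℝ≥0∞) :
    condExpect f Φ θ v b n F =
      sysExpect (condPolicy Φ v b) (fun _ a => f (θ a)) n fun x => F (glue b x) := by
  refine tsum_congr fun x => ?_
  congr 1
  refine Finset.prod_congr rfl fun t _ => ?_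
  rw [← Finset.prod_coe_sort (nbhd G v)]
  refine Finset.prod_congr rfl fun u _ => ?_
  rw [stepProb, glue_apply]
  rfl

theorem pulls_glue {v : V} (b : OutsidePath G K S v) (i : Fin K) {n : ℕ}
    (x : Path {u // u ∈ nbhd G v} K S n) (u : {u // u ∈ nbhd G v}) :
    pulls i (u : V) (glue b x) = pulls i u x := by
  simp only [pulls, glue_apply]

theorem nbhdPulls_glue {v : V} (b : OutsidePath G K S v) (i : Fin K) {n : ℕ}
    (x : Path {u // u ∈ nbhd G v} K S n) :
    nbhdPulls G i v (glue b x) = count Finset.univ i x := by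
  rw [nbhdPulls, ← Finset.sum_coe_sort (nbhd G v), count]
  exact Finset.sum_congr rfl fun u _ => pulls_glue b i x u

theorem pulls_le {V : Type*} (i : Fin K) (u : V) {n : ℕ} (ω : Path V K S n) : pulls i u ω ≤ n := by
  have := Finset.card_filter_le (Finset.univ : Finset (Fin n)) fun t => (ω t u).1 = i
  simpa [pulls] using this

/-! ### Replacing the rewards outside a neighbourhood by a tape -/

open Classical in
/-- Reward distributions that are those of `θ'` inside `𝒩(v)` and those of `θ` outside. -/
def hybridReward (G : SimpleGraph V) (f : Θ → PMF S) (θ θ' : Fin K → Θ) (v u : V) (a : Fin K) :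
    PMF S :=
  if u ∈ nbhd G v then f (θ' a) else f (θ a)

open Classical in
/-- The policies that read the rewards of arm `j` outside `𝒩(v)` from the tape `r`. -/
def tapePolicy (Φ : (v : V) → Policy G K S v) (v : V) (j : Fin K) {n : ℕ} (r : Fin n → V → S)
    (u : V) : Policy G K S u :=
  fun t obs => Φ u t fun s w =>
    if h : ((w : V) ∉ nbhd G v ∧ (obs s w).1 = j) ∧ (s : ℕ) < n then (j, r ⟨s, h.2⟩ w) else obs s w

/-- Node `v` observes nothing outside `𝒩(v)`, so the tape leaves its policy unchanged and what is
assumed of that policy still applies. -/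
theorem tapePolicy_self (Φ : (v : V) → Policy G K S v) (v : V) (j : Fin K) {n : ℕ}
    (r : Fin n → V → S) : tapePolicy Φ v j r v = Φ v := by
  funext t obs
  unfold tapePolicy
  congr 1
  funext s w
  rw [dif_neg]
  exact fun h => h.1.1 w.2

open Classical in
/-- Exchange rewards and tape entries of the nodes outside `𝒩(v)` that play arm `j`. -/
def swapTape (G : SimpleGraph V) (v : V) (j : Fin K) {n : ℕ}
    (z : Fin n → V → (Fin K × S) × S) : Fin n → V → (Fin K × S) × S :=
  fun t u => if u ∉ nbhd G v ∧ (z t u).1.1 = j then ((j, (z t u).2), (z t u).1.2) else z t u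

theorem swapTape_involutive (G : SimpleGraph V) (v : V) (j : Fin K) {n : ℕ} :
    Function.Involutive (swapTape (S := S) G v j (n := n)) := by
  intro z
  funext t u
  by_cases h : u ∉ nbhd G v ∧ (z t u).1.1 = j
  · have h1 : swapTape G v j z t u = ((j, (z t u).2), (z t u).1.2) := if_pos h
    rw [swapTape, h1, if_pos ⟨h.1, rfl⟩]
    refine Prod.ext (Prod.ext h.2.symm rfl) rfl
  · have h1 : swapTape G v j z t u = z t u := if_neg h
    rw [swapTape, h1, if_neg h]

theorem tsum_tape {n : ℕ} (p : Fin n → V → PMF S) :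
    ∑' r : Fin n → V → S, ∏ t, ∏ u, p t u (r t u) = 1 := by
  rw [tsum_pi_prod fun t (y : V → S) => ∏ u, p t u (y u)]
  refine Finset.prod_eq_one fun t _ => ?_
  rw [tsum_pi_prod fun u (y : S) => p t u y]
  exact Finset.prod_eq_one fun u _ => (p t u).tsum_coe

/-- Split a path with tape into the path and the tape. -/
def tapeEquiv (V : Type*) (K : ℕ) (S : Set ℝ) (n : ℕ) :
    (Fin n → V → (Fin K × S) × S) ≃ (Path V K S n) × (Fin n → V → S) where
  toFun z := (fun t u => (z t u).1, fun t u => (z t u).2)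
  invFun y := fun t u => (y.1 t u, y.2 t u)
  left_inv _ := rfl
  right_inv _ := rfl

/-- For functions of the actions, the system with hybrid rewards is a mixture of networks with the
reward distributions `θ'` in which nodes read the rewards outside `𝒩(v)` from a tape. -/
theorem sysExpect_hybrid (f : Θ → PMF S) (Φ : (v : V) → Policy G K S v) {θ θ' : Fin K → Θ}
    {j : Fin K} (hθ : ∀ a, a ≠ j → θ' a = θ a) (v : V) (n : ℕ) (F : Path V K S n → ℝ≥0∞)
    (hF : ∀ ω ω' : Path V K S n, (∀ t u, (ω t u).1 = (ω' t u).1) → F ω = F ω') :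
    sysExpect (netPolicy Φ) (hybridReward G f θ θ' v) n F =
      ∑' r : Fin n → V → S, (∏ t, ∏ u, f (θ j) (r t u)) * expect f (tapePolicy Φ v j r) θ' n F := by
  classical
  -- Attach an unused tape whose conditional law given the path is arranged so that, after the swap,
  -- the tape is independent with law `f (θ j)` and the rewards have the parameters `θ'`.
  have h1 : sysExpect (netPolicy Φ) (hybridReward G f θ θ' v) n F =
      ∑' y : (Path V K S n) × (Fin n → V → S),
        sysProb (netPolicy Φ) (hybridReward G f θ θ' v) y.1 * F y.1 *
          ∏ t, ∏ u, (if u ∉ nbhd G v ∧ (y.1 t u).1 = j then f (θ' j) else f (θ j)) (y.2 t u) := by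
    rw [ENNReal.tsum_prod']
    refine tsum_congr fun ω => ?_
    dsimp only
    rw [ENNReal.tsum_mul_left, tsum_tape fun t u => if u ∉ nbhd G v ∧ (ω t u).1 = j then f (θ' j) else f (θ j), mul_one]
  have h2 : ∑' r : Fin n → V → S,
        (∏ t, ∏ u, f (θ j) (r t u)) * expect f (tapePolicy Φ v j r) θ' n F =
      ∑' y : (Path V K S n) × (Fin n → V → S), (∏ t, ∏ u, f (θ j) (y.2 t u)) *
        ((∏ t, ∏ u, stepProb f (tapePolicy Φ v j y.2) θ' y.1 t u) * F y.1) := by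
    rw [ENNReal.tsum_prod', ENNReal.tsum_comm]
    refine tsum_congr fun r => ?_
    dsimp only
    rw [ENNReal.tsum_mul_left, expect]
  rw [h1, h2, ← (tapeEquiv V K S n).tsum_eq, ← (tapeEquiv V K S n).tsum_eq,
    ← (swapTape_involutive G v j).toPerm.tsum_eq]
  refine tsum_congr fun z => ?_
  set ω : Path V K S n := fun t u => (z t u).1 with hω
  set r : Fin n → V → S := fun t u => (z t u).2 with hr
  set ω' : Path V K S n := fun t u => (swapTape G v j z t u).1 with hω'
  set r' : Fin n → V → S := fun t u => (swapTape G v j z t u).2 with hr'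
  have hact : ∀ t u, (ω' t u).1 = (ω t u).1 := by
    intro t u
    simp only [hω', hω, swapTape]
    split_ifs with h
    · exact h.2.symm
    · rfl
  change sysProb (netPolicy Φ) (hybridReward G f θ θ' v) ω' * F ω' *
      ∏ t, ∏ u, (if u ∉ nbhd G v ∧ (ω' t u).1 = j then f (θ' j) else f (θ j)) (r' t u) =
    (∏ t, ∏ u, f (θ j) (r t u)) *
      ((∏ t, ∏ u, stepProb f (tapePolicy Φ v j r) θ' ω t u) * F ω)
  rw [hF ω' ω hact, mul_right_comm, ← mul_assoc]
  congr 1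
  rw [sysProb]
  simp only [← Finset.prod_mul_distrib]
  refine Finset.prod_congr rfl fun t _ => Finset.prod_congr rfl fun u _ => ?_
  -- A policy acting on the swapped history sees exactly what the tape policy reads on the original
  -- one.
  have hpol : netPolicy Φ t (hist ω' t) u = tapePolicy Φ v j r u t (observed G ω t u) := by
    unfold netPolicy tapePolicy
    congr 1
    funext s w
    have hs : (s : ℕ) < n := s.2.trans t.2
    by_cases h : (w : V) ∉ nbhd G v ∧ (ω ⟨s, hs⟩ w).1 = j
    · rw [dif_pos ⟨h, hs⟩]
      change (swapTape G v j z ⟨s, hs⟩ w).1 = _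
      rw [swapTape, if_pos h]
    · rw [dif_neg fun hh => h hh.1]
      change (swapTape G v j z ⟨s, hs⟩ w).1 = _
      rw [swapTape, if_neg h]
      rfl
  rw [hpol, stepProb, hact]
  by_cases h : u ∉ nbhd G v ∧ (ω t u).1 = j
  · have e1 : (ω' t u).2 = r t u := by
      simp only [hω', swapTape]; rw [if_pos h]
    have e2 : r' t u = (ω t u).2 := by
      simp only [hr', swapTape]; rw [if_pos h]
    rw [if_pos h, e1, e2, hybridReward, if_neg h.1, h.2]
    ring
  · have e1 : (ω' t u).2 = (ω t u).2 := by
      simp only [hω', swapTape]; rw [if_neg h]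
    have e2 : r' t u = r t u := by
      simp only [hr', swapTape]; rw [if_neg h]
    have e3 : hybridReward G f θ θ' v u (ω t u).1 = f (θ' (ω t u).1) := by
      by_cases hu : u ∈ nbhd G v
      · rw [hybridReward, if_pos hu]
      · rw [hybridReward, if_neg hu, hθ _ fun h' => h ⟨hu, h'⟩]
    rw [if_neg h, e1, e2, e3]
    ring

theorem sysExpect_hybrid_le (f : Θ → PMF S) (Φ : (v : V) → Policy G K S v) {θ θ' : Fin K → Θ}
    {j : Fin K} (hθ : ∀ a, a ≠ j → θ' a = θ a) (v : V) (n : ℕ) (F : Path V K S n → ℝ≥0∞)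
    (hF : ∀ ω ω' : Path V K S n, (∀ t u, (ω t u).1 = (ω' t u).1) → F ω = F ω') {c : ℝ≥0∞}
    (hc : ∀ r : Fin n → V → S, expect f (tapePolicy Φ v j r) θ' n F ≤ c) :
    sysExpect (netPolicy Φ) (hybridReward G f θ θ' v) n F ≤ c := by
  rw [sysExpect_hybrid f Φ hθ v n F hF]
  refine (ENNReal.tsum_le_tsum fun r => mul_le_mul_right (hc r) _).trans ?_
  rw [ENNReal.tsum_mul_right, tsum_tape fun _ _ => f (θ j), one_mul]

/-! ### Stopping a node when its neighbourhood has played an arm often -/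

/-- How often node `u` plays arm `j` in the first `t` rounds. -/
def playsBefore {V : Type*} (j : Fin K) (u : V) {n : ℕ} (ω : Path V K S n) (t : ℕ) : ℕ :=
  (Finset.univ.filter fun s : Fin n => (s : ℕ) < t ∧ (ω s u).1 = j).card

theorem nbhdPullsBefore_eq (j : Fin K) (v : V) {n : ℕ} (ω : Path V K S n) (t : Fin n) :
    nbhdPullsBefore G j v ω t = ∑ u ∈ nbhd G v, playsBefore j u ω t := rfl

theorem playsBefore_mono {V : Type*} (j : Fin K) (u : V) {n : ℕ} (ω : Path V K S n) :
    Monotone (playsBefore j u ω) := fun _ _ h =>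
  Finset.card_le_card fun _ hx => by
    simp only [Finset.mem_filter, Finset.mem_univ, true_and] at hx ⊢
    exact ⟨hx.1.trans_le h, hx.2⟩

theorem playsBefore_all {V : Type*} (j : Fin K) (u : V) {n : ℕ} (ω : Path V K S n) :
    playsBefore j u ω n = pulls j u ω := by
  simp [playsBefore, pulls]

theorem playsBefore_congr {V : Type*} (j : Fin K) (u : V) {n : ℕ} (ω ω' : Path V K S n)
    (h : ∀ t u, (ω t u).1 = (ω' t u).1) (t : ℕ) : playsBefore j u ω t = playsBefore j u ω' t := by
  unfold playsBefore
  congr 1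
  ext s
  simp only [Finset.mem_filter, h]

theorem playsBefore_succ_le {V : Type*} (j : Fin K) (u : V) {n : ℕ} (ω : Path V K S n) (t : ℕ) :
    playsBefore j u ω (t + 1) ≤ playsBefore j u ω t + 1 := by
  classical
  have h1 : (Finset.univ.filter fun s : Fin n => (s : ℕ) = t).card ≤ 1 :=
    Finset.card_le_one.mpr fun a ha b hb => by
      simp only [Finset.mem_filter, Finset.mem_univ, true_and] at ha hb
      exact Fin.ext (ha.trans hb.symm)
  refine le_trans (le_trans (Finset.card_le_card ?_) (Finset.card_union_le _ _))
    (Nat.add_le_add_left h1 _)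
  intro s hs
  simp only [Finset.mem_filter, Finset.mem_univ, true_and, Finset.mem_union] at hs ⊢
  rcases Nat.lt_succ_iff_lt_or_eq.mp hs.1 with h | h
  · exact Or.inl ⟨h, hs.2⟩
  · exact Or.inr h

theorem exists_stop (G : SimpleGraph V) (j : Fin K) (v : V) (c : ℝ) {n : ℕ} (ω : Path V K S n) :
    ∃ t, t = n ∨ c ≤ ∑ u ∈ nbhd G v, (playsBefore j u ω t : ℝ) := ⟨n, Or.inl rfl⟩

open Classical in
/-- The first round before which `𝒩(v)` has played arm `j` at least `c` times, or the horizon. -/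
def stopTime (G : SimpleGraph V) (j : Fin K) (v : V) (c : ℝ) {n : ℕ} (ω : Path V K S n) : ℕ :=
  Nat.find (exists_stop G j v c ω)

theorem stopTime_spec (G : SimpleGraph V) (j : Fin K) (v : V) (c : ℝ) {n : ℕ} (ω : Path V K S n) :
    stopTime G j v c ω = n ∨
      c ≤ ∑ u ∈ nbhd G v, (playsBefore j u ω (stopTime G j v c ω) : ℝ) := by
  classical
  exact Nat.find_spec (exists_stop G j v c ω)

theorem stopTime_le (G : SimpleGraph V) (j : Fin K) (v : V) (c : ℝ) {n : ℕ} (ω : Path V K S n) :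
    stopTime G j v c ω ≤ n := by
  classical
  exact Nat.find_min' (exists_stop G j v c ω) (Or.inl rfl)

theorem lt_of_lt_stopTime {j : Fin K} {v : V} {c : ℝ} {n : ℕ} {ω : Path V K S n}
    {t : ℕ} (ht : t < stopTime G j v c ω) : ∑ u ∈ nbhd G v, (playsBefore j u ω t : ℝ) < c := by
  classical
  exact not_le.mp fun h => Nat.find_min (exists_stop G j v c ω) ht (Or.inr h)

/-- Once the neighbourhood has reached `c` plays it stays above `c`, so every later play by `v` is
counted by `pullsAfter`. -/
theorem playsBefore_le_min_add (j : Fin K) (v : V) (c : ℝ) {n : ℕ} (ω : Path V K S n) {t : ℕ}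
    (ht : t ≤ n) :
    playsBefore j v ω t ≤
      playsBefore j v ω (min t (stopTime G j v c ω)) + pullsAfter G j v c ω := by
  classical
  rcases le_or_gt t (stopTime G j v c ω) with h | h
  · rw [min_eq_left h]; exact Nat.le_add_right _ _
  · rw [min_eq_right h.le]
    have hc := (stopTime_spec G j v c ω).resolve_left (h.trans_le ht).ne
    refine (Finset.card_le_card ?_).trans (Finset.card_union_le _ _)
    intro s hs
    simp only [Finset.mem_filter, Finset.mem_univ, true_and, Finset.mem_union] at hs ⊢
    rcases lt_or_ge (s : ℕ) (stopTime G j v c ω) with h1 | h1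
    · exact Or.inl ⟨h1, hs.2⟩
    · refine Or.inr ⟨hs.2, hc.trans ?_⟩
      rw [nbhdPullsBefore_eq, Nat.cast_sum]
      exact Finset.sum_le_sum fun u _ => Nat.cast_le.mpr (playsBefore_mono j u ω h1)

theorem pulls_le_add_pullsAfter (G : SimpleGraph V) (j : Fin K) (v : V) (c : ℝ) {n : ℕ}
    (ω : Path V K S n) :
    (pulls j v ω : ℝ) ≤ max c 0 + 1 + pullsAfter G j v c ω := by
  have h1 := playsBefore_le_min_add (G := G) j v c ω le_rfl
  rw [min_eq_right (stopTime_le G j v c ω), playsBefore_all] at h1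
  have h2 : (playsBefore j v ω (stopTime G j v c ω) : ℝ) ≤ max c 0 + 1 := by
    -- One round before a positive stopping time the neighbourhood, and so `v`, has fewer than `c`
    -- plays; the last round adds at most one. At stopping time zero `c` may be negative, hence `max
    -- c 0`.
    rcases hτ : stopTime G j v c ω with _ | m
    · simp only [playsBefore, Nat.not_lt_zero, false_and, Finset.filter_false, Finset.card_empty,
        Nat.cast_zero]
      positivity
    · have h3 := lt_of_lt_stopTime (G := G) (j := j) (v := v) (c := c) (ω := ω) (t := m) (by omega)
      have h4 : (playsBefore j v ω m : ℝ) ≤ ∑ u ∈ nbhd G v, (playsBefore j u ω m : ℝ) :=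
        Finset.single_le_sum (f := fun u => (playsBefore j u ω m : ℝ))
          (fun _ _ => Nat.cast_nonneg _) (mem_nbhd_self G v)
      have h5 : (playsBefore j v ω (m + 1) : ℝ) ≤ playsBefore j v ω m + 1 := by
        exact_mod_cast playsBefore_succ_le j v ω m
      linarith [le_max_left c 0]
  have h3 : (pulls j v ω : ℝ) ≤
      playsBefore j v ω (stopTime G j v c ω) + pullsAfter G j v c ω := by exact_mod_cast h1
  linarith

theorem pullsAfter_anti (G : SimpleGraph V) (j : Fin K) (v : V) {c c' : ℝ} (h : c ≤ c') {n : ℕ}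
    (ω : Path V K S n) : pullsAfter G j v c' ω ≤ pullsAfter G j v c ω := by
  classical
  refine Finset.card_le_card fun t ht => ?_
  simp only [Finset.mem_filter, Finset.mem_univ, true_and] at ht ⊢
  exact ⟨ht.1, h.trans ht.2⟩

theorem pullsAfter_congr (G : SimpleGraph V) (j : Fin K) (v : V) (c : ℝ) {n : ℕ}
    (ω ω' : Path V K S n) (h : ∀ t u, (ω t u).1 = (ω' t u).1) :
    pullsAfter G j v c ω = pullsAfter G j v c ω' := by
  unfold pullsAfter
  congr 1
  ext t
  have hb : nbhdPullsBefore G j v ω t = nbhdPullsBefore G j v ω' t :=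
    Finset.sum_congr rfl fun u _ => playsBefore_congr j u ω ω' h t
  rw [Finset.mem_filter, Finset.mem_filter, hb, h]

/-! ### The optimisation problem bounds the number of plays on a path -/

theorem totals_nonneg (G : SimpleGraph V) (q : ℝ) : ∀ s ∈ totals G q, 0 ≤ s := by
  rintro s ⟨η, z, -, l, -, rfl⟩
  exact Finset.sum_nonneg fun _ _ => abs_nonneg _

theorem graphConst_nonneg (G : SimpleGraph V) : 0 ≤ graphConst G :=
  Real.sInf_nonneg (totals_nonneg G 1)

/-- If every neighbourhood plays arm `j` at least `Q` times, then the network plays it about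
`L_G * Q` times, up to the plays of nodes whose neighbourhoods have already played it often. -/
theorem graphConst_mul_le_netPulls (G : SimpleGraph V) (j : Fin K) {Q : ℝ} {c : V → ℝ}
    (hc : ∀ v, Q ≤ c v) {n : ℕ} (ω : Path V K S n) (hQ : ∀ v, Q ≤ nbhdPulls G j v ω) :
    graphConst G * Q ≤
      netPulls j ω + graphConst G * ∑ v, (pullsAfter G j v (c v) ω : ℝ) := by
  classical
  set A : ℝ := ∑ v, (pullsAfter G j v (c v) ω : ℝ) with hA
  rcases le_or_gt (Q - A) 0 with h0 | h0
  · have h1 := mul_le_mul_of_nonneg_left (by linarith : Q ≤ A) (graphConst_nonneg G)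
    have h2 : (0 : ℝ) ≤ netPulls j ω := Nat.cast_nonneg _
    linarith
  suffices h : graphConst G * (Q - A) ≤ netPulls j ω by linarith
  rw [← minTotal_div G h0, div_mul_cancel₀ _ h0.ne', minTotal]
  -- With no nodes there is no last index, so the set of totals is empty and its infimum is the
  -- default value `0`.
  rcases isEmpty_or_nonempty V with hV | hV
  · have h1 : totals G (Q - A) = ∅ := by
      refine Set.eq_empty_of_forall_notMem ?_
      rintro s ⟨η, -, -, l, -, -⟩
      exact hV.false (η l)
    rw [h1, Real.sInf_empty]
    exact Nat.cast_nonneg _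
  set τ : V → ℕ := fun v => stopTime G j v (c v) ω with hτ
  set e : Fin (Fintype.card V) ≃ V := (Fintype.equivFin V).symm with he
  set η : Fin (Fintype.card V) ≃ V := (Tuple.sort (τ ∘ e)).trans e with hη
  have hmono : Monotone (τ ∘ η) := Tuple.monotone_sort (τ ∘ e)
  -- Plays of `u` up to the stopping time of `η k`, with `u` frozen at its own stopping time.
  -- Sorting by stopping time gives monotonicity and freezing.
  set z : Fin (Fintype.card V) → V → ℝ :=
    fun k u => playsBefore j u ω (min (τ (η k)) (τ u)) with hz
  have hcard : 0 < Fintype.card V := Fintype.card_pos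
  have hfeas : Feasible G (Q - A) η z := by
    refine ⟨fun k v => Nat.cast_nonneg _, fun k l hkl u => ?_, fun k i hki => ?_, fun k => ?_⟩
    · exact Nat.cast_le.mpr (playsBefore_mono j u ω (min_le_min_right _ (hmono hkl)))
    · have h1 : τ (η k) ≤ τ (η i) := hmono hki
      simp only [hz, min_eq_right h1, min_self]
    -- When `η k` stops, its neighbourhood has `Q` true plays of `j`. Those missing from `z k` were
    -- made by neighbours already stopped, and number at most `A`.
    · have h1 : Q ≤ ∑ u ∈ nbhd G (η k), (playsBefore j u ω (τ (η k)) : ℝ) := by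
        rcases stopTime_spec G j (η k) (c (η k)) ω with h | h
        · refine (hQ (η k)).trans (le_of_eq ?_)
          simp only [hτ, h, playsBefore_all]
          rw [nbhdPulls, Nat.cast_sum]
        · exact (hc _).trans h
      have h2 : ∑ u ∈ nbhd G (η k), (playsBefore j u ω (τ (η k)) : ℝ) ≤
          ∑ u ∈ nbhd G (η k), (z k u + pullsAfter G j u (c u) ω) :=
        Finset.sum_le_sum fun u _ => by
          have := playsBefore_le_min_add (G := G) j u (c u) ω (stopTime_le G j (η k) (c (η k)) ω)
          simp only [hz]
          exact_mod_cast this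
      have h3 : ∑ u ∈ nbhd G (η k), (pullsAfter G j u (c u) ω : ℝ) ≤ A :=
        Finset.sum_le_sum_of_subset_of_nonneg (Finset.subset_univ _)
          fun _ _ _ => Nat.cast_nonneg _
      rw [Finset.sum_add_distrib] at h2
      linarith
  refine (csInf_le ⟨0, totals_nonneg G _⟩
    ⟨η, z, hfeas, ⟨Fintype.card V - 1, by omega⟩, by simp only; omega, rfl⟩).trans ?_
  rw [netPulls, Nat.cast_sum]
  refine Finset.sum_le_sum fun u _ => ?_
  rw [abs_of_nonneg (hfeas.nonneg _ _), ← playsBefore_all]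
  exact Nat.cast_le.mpr (playsBefore_mono j u ω ((min_le_right _ _).trans (stopTime_le G j u _ ω)))

end Network

section Main

variable {V : Type*} [Fintype V] {G : SimpleGraph V} {K : ℕ} {S : Set ℝ} {Θ : Type*}

/-! ### Consistency after changing the parameter of one arm -/

theorem eventually_condExpect_pulls_le {f : Θ → PMF S} {Φ : (v : V) → Policy G K S v} {v : V}
    (hv : IndividuallyConsistent f v (Φ v)) {θ : Fin K → Θ} {i : Fin K} (hi : Suboptimal f θ i)
    (b : OutsidePath G K S v) {a : ℝ} (ha : 0 < a) :
    ∀ᶠ n : ℕ in atTop, sysExpect (condPolicy Φ v b) (fun _ k => f (θ k)) n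
      (fun x => (pulls i ⟨v, mem_nbhd_self G v⟩ x : ℝ≥0∞)) ≤ ENNReal.ofReal ((n : ℝ) ^ a) := by
  have h := (hv θ i hi Φ rfl b a ha).def (c := 1) one_pos
  filter_upwards [h] with n hn
  have h1 : condExpect f Φ θ v b n (fun ω => (pulls i v ω : ℝ≥0∞)) =
      sysExpect (condPolicy Φ v b) (fun _ k => f (θ k)) n
        (fun x => (pulls i ⟨v, mem_nbhd_self G v⟩ x : ℝ≥0∞)) := by
    rw [condExpect_eq_sysExpect]
    congr 1
    funext x
    rw [← pulls_glue b]
  rw [h1, one_mul, Real.norm_of_nonneg ENNReal.toReal_nonneg,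
    Real.norm_of_nonneg (by positivity)] at hn
  refine (ENNReal.le_ofReal_iff_toReal_le ?_ (by positivity)).mpr hn
  -- Consistency is stated through `toReal`, which sends `∞` to `0`; the bound by `n` rules that
  -- out.
  refine ne_top_of_le_ne_top (ENNReal.natCast_ne_top n) ?_
  rw [← sysExpect_const (condPolicy Φ v b) (fun _ k => f (θ k)) n (n : ℝ≥0∞)]
  refine sysExpect_mono _ _ fun x => ?_
  exact_mod_cast pulls_le i _ x

/-- For each tape the network is a genuine one under `θ'` in which `v` keeps its policy.
Non-altruism bounds its late plays by the same constant for all tapes, and its early plays are of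
order `log n`. -/
theorem eventually_hybrid_pulls_le {f : Θ → PMF S} {Φ : (v : V) → Policy G K S v} {v : V}
    (hv : NonAltruistic f v (Φ v)) {θ θ' : Fin K → Θ} {j : Fin K}
    (hθ : ∀ a, a ≠ j → θ' a = θ a) {i : Fin K} (hi : Suboptimal f θ' i) {a : ℝ} (ha : 0 < a) :
    ∀ᶠ n : ℕ in atTop, sysExpect (netPolicy Φ) (hybridReward G f θ θ' v) n
      (fun ω => (pulls i v ω : ℝ≥0∞)) ≤ ENNReal.ofReal ((n : ℝ) ^ a) := by
  obtain ⟨a₁, a₂, h⟩ := hv θ'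
  have hlog : (fun n : ℕ => |a₁| * Real.log n + (1 + (a₂ : ℝ))) =o[atTop] fun n : ℕ => (n : ℝ) ^ a := by
    refine IsLittleO.add ?_ ?_
    · exact ((isLittleO_log_rpow_atTop ha).comp_tendsto tendsto_natCast_atTop_atTop).const_mul_left _
    · refine isLittleO_const_left.mpr (Or.inr ?_)
      exact tendsto_norm_atTop_atTop.comp ((tendsto_rpow_atTop ha).comp tendsto_natCast_atTop_atTop)
  filter_upwards [hlog.def (c := 1) one_pos, eventually_ge_atTop 1] with n hn hn1
  have hlog0 : 0 ≤ Real.log n := Real.log_natCast_nonneg n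
  rw [one_mul, Real.norm_of_nonneg (by positivity), Real.norm_of_nonneg (by positivity)] at hn
  have h1 : sysExpect (netPolicy Φ) (hybridReward G f θ θ' v) n
      (fun ω => (pullsAfter G i v (a₁ * Real.log n) ω : ℝ≥0∞)) ≤ a₂ :=
    sysExpect_hybrid_le f Φ hθ v n _
      (fun ω ω' hω => congrArg _ (pullsAfter_congr G i v _ ω ω' hω))
      fun r => h n i hi _ (tapePolicy_self Φ v j r)
  have h2 : ∀ ω : Path V K S n, (pulls i v ω : ℝ≥0∞) ≤
      ENNReal.ofReal (|a₁| * Real.log n + 1) + pullsAfter G i v (a₁ * Real.log n) ω := by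
    intro ω
    rw [← ENNReal.ofReal_natCast, ← ENNReal.ofReal_natCast (pullsAfter G i v _ ω),
      ← ENNReal.ofReal_add (by positivity) (Nat.cast_nonneg _)]
    refine ENNReal.ofReal_le_ofReal ((pulls_le_add_pullsAfter G i v (a₁ * Real.log n) ω).trans ?_)
    have : max (a₁ * Real.log n) 0 ≤ |a₁| * Real.log n :=
      max_le (mul_le_mul_of_nonneg_right (le_abs_self _) hlog0) (by positivity)
    linarith
  refine (sysExpect_mono _ _ h2).trans ?_
  rw [sysExpect_add, sysExpect_const]
  refine (add_le_add_right h1 _).trans ?_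
  rw [← ENNReal.ofReal_coe_nnreal, ← ENNReal.ofReal_add (by positivity) (by positivity)]
  exact ENNReal.ofReal_le_ofReal (by linarith)

/-- A parameter of slightly larger mean than the optimal one makes `j` the only optimal arm. -/
theorem exists_alternative {f : Θ → PMF S} (hA1 : A1 f) {θ : Fin K → Θ} {j star : Fin K}
    (hj : Suboptimal f θ j) (hstar : Optimal f θ star) {q : ℝ} (hq : 0 < q)
    (hqκ : q * (kl f (θ j) (θ star)).toReal < 1) :
    ∃ θ' : Fin K → Θ, (∀ a, a ≠ j → θ' a = θ a) ∧ (∀ i, i ≠ j → Suboptimal f θ' i) ∧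
      kl f (θ j) (θ' j) ≠ ∞ ∧ q * (kl f (θ j) (θ' j)).toReal < 1 := by
  classical
  obtain ⟨k, hk⟩ := hj
  have hjs : mean (f (θ j)) < mean (f (θ star)) := hk.trans_le (hstar k)
  have hε : 0 < 1 / q - (kl f (θ j) (θ star)).toReal := by
    rw [sub_pos, lt_div_iff₀ hq]; linarith
  -- The tolerance is the slack of the divergence below `1 / q`, so the strict inequality with `q`
  -- survives the perturbation.
  obtain ⟨η, hη, hcont⟩ := hA1.continuity _ hε _ _ hjs
  obtain ⟨lam, hl1, hl2⟩ := hA1.denseness (θ star) η hη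
  refine ⟨Function.update θ j lam, fun a ha => Function.update_of_ne ha _ _, fun i hi => ⟨j, ?_⟩,
    ?_, ?_⟩
  · rw [Function.update_of_ne hi, Function.update_self]
    exact (hstar i).trans_lt hl1
  · rw [Function.update_self]
    exact (hA1.pos_finite _ _ (hjs.trans hl1)).2.ne
  · rw [Function.update_self]
    have h := (abs_lt.mp (hcont lam hl1.le hl2.le)).1
    have h2 : (kl f (θ j) lam).toReal < 1 / q := by linarith
    rw [lt_div_iff₀ hq] at h2
    linarith

/-! ### Lower bounds in probability -/

theorem tendsto_condExpect_nbhdPulls_lt {f : Θ → PMF S} (hfull : ∀ (β : Θ) (x : S), f β x ≠ 0)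
    (hA1 : A1 f) {Φ : (v : V) → Policy G K S v} {v : V} (hv : IndividuallyConsistent f v (Φ v))
    {θ : Fin K → Θ} {j star : Fin K} (hj : Suboptimal f θ j) (hstar : Optimal f θ star)
    (b : OutsidePath G K S v) {q : ℝ} (hq : 0 < q)
    (hqκ : q * (kl f (θ j) (θ star)).toReal < 1) :
    Tendsto (fun n : ℕ => sysExpect (condPolicy Φ v b) (fun _ k => f (θ k)) n
      fun x => ind ((nbhdPulls G j v (glue b x) : ℝ) < q * Real.log n)) atTop (𝓝 0) := by
  obtain ⟨θ', hθ, hsub, hfin, hqκ'⟩ := exists_alternative hA1 hj hstar hq hqκ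
  simp only [nbhdPulls_glue]
  refine tendsto_count_lt (condPolicy Φ v b) (hfull (θ j)) (hfull (θ' j)) ENNReal.toReal_nonneg
    (hasSum_logRatio (hfull _) (hfull _) hfin) hq hqκ' _ (fun _ k => f (θ' k)) Finset.univ j
    (fun _ _ => rfl) (fun _ _ => rfl) (fun u a h => ?_)
    (Finset.mem_univ (⟨v, mem_nbhd_self G v⟩ : {u // u ∈ nbhd G v}))
    fun a ha i hi => eventually_condExpect_pulls_le hv (hsub i hi) b ha
  rw [hθ a fun h' => h ⟨Finset.mem_univ _, h'⟩]

/-- The alternative alters arm `j` only inside `𝒩(v)`; altering it at every node would put the plays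
of the whole network into the likelihood ratio. -/
theorem tendsto_expect_nbhdPulls_lt {f : Θ → PMF S} (hfull : ∀ (β : Θ) (x : S), f β x ≠ 0)
    (hA1 : A1 f) {Φ : (v : V) → Policy G K S v} {v : V} (hv : NonAltruistic f v (Φ v))
    {θ : Fin K → Θ} {j star : Fin K} (hj : Suboptimal f θ j) (hstar : Optimal f θ star)
    {q : ℝ} (hq : 0 < q) (hqκ : q * (kl f (θ j) (θ star)).toReal < 1) :
    Tendsto (fun n : ℕ => sysExpect (netPolicy Φ) (fun _ k => f (θ k)) n
      fun ω => ind ((nbhdPulls G j v ω : ℝ) < q * Real.log n)) atTop (𝓝 0) := by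
  obtain ⟨θ', hθ, hsub, hfin, hqκ'⟩ := exists_alternative hA1 hj hstar hq hqκ
  refine tendsto_count_lt (netPolicy Φ) (hfull (θ j)) (hfull (θ' j)) ENNReal.toReal_nonneg
    (hasSum_logRatio (hfull _) (hfull _) hfin) hq hqκ' _ (hybridReward G f θ θ' v) (nbhd G v) j
    (fun _ _ => rfl) (fun u hu => ?_) (fun u a h => ?_) (mem_nbhd_self G v)
    fun a ha i hi => eventually_hybrid_pulls_le hv hθ (hsub i hi) ha
  · rw [hybridReward, if_pos hu]
  · by_cases hu : u ∈ nbhd G v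
    · rw [hybridReward, if_pos hu, hθ a fun h' => h ⟨hu, h'⟩]
    · rw [hybridReward, if_neg hu]

/-- The network bound: non-altruistic nodes whose neighbourhoods play arm `j` at least `q log n`
times with probability tending to one together play it about `L_G * q * log n` times. -/
theorem le_liminf_netPulls {f : Θ → PMF S} {Φ : (v : V) → Policy G K S v}
    (hΦ : ∀ v, NonAltruistic f v (Φ v)) {θ : Fin K → Θ} {j : Fin K} (hj : Suboptimal f θ j)
    {q q' : ℝ} (hq' : 0 ≤ q') (hq : q' < q)
    (hprob : ∀ v, Tendsto (fun n : ℕ => sysExpect (netPolicy Φ) (fun _ k => f (θ k)) n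
      fun ω => ind ((nbhdPulls G j v ω : ℝ) < q * Real.log n)) atTop (𝓝 0)) :
    ENNReal.ofReal (graphConst G * q') ≤
      liminf (fun n : ℕ => (expect f Φ θ n fun ω => (netPulls j ω : ℝ≥0∞)) /
        ENNReal.ofReal (Real.log n)) atTop := by
  -- Positivity of the constant is needed for the strict inequality `L * q' < L * q`.
  rcases (graphConst_nonneg G).eq_or_lt with hL | hL
  · rw [← hL]; simp
  set L := graphConst G with hLd
  choose a₁ a₂ h using fun v => hΦ v θ
  set C : ℝ≥0∞ := ∑ v, (a₂ v : ℝ≥0∞) with hC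
  have hCtop : C ≠ ∞ := ENNReal.sum_ne_top.mpr fun _ _ => ENNReal.coe_ne_top
  have hlogt : Tendsto (fun n : ℕ => ENNReal.ofReal (Real.log n)) atTop (𝓝 ∞) :=
    ENNReal.tendsto_ofReal_atTop.comp (Real.tendsto_log_atTop.comp tendsto_natCast_atTop_atTop)
  have he1 : Tendsto (fun n : ℕ => ENNReal.ofReal L * C / ENNReal.ofReal (Real.log n)) atTop
      (𝓝 0) := by
    have := ENNReal.Tendsto.const_div (a := ENNReal.ofReal L * C) hlogt
      (Or.inr (ENNReal.mul_ne_top ENNReal.ofReal_ne_top hCtop))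
    rwa [ENNReal.div_top] at this
  have he2 : Tendsto (fun n : ℕ => ENNReal.ofReal (L * q) *
      ∑ v, sysExpect (netPolicy Φ) (fun _ k => f (θ k)) n
        fun ω => ind ((nbhdPulls G j v ω : ℝ) < q * Real.log n)) atTop (𝓝 0) := by
    have h1 := ENNReal.Tendsto.const_mul (a := ENNReal.ofReal (L * q))
      (tendsto_finsetSum Finset.univ fun v _ => hprob v) (Or.inr ENNReal.ofReal_ne_top)
    simpa using h1
  have he := he1.add he2
  rw [add_zero] at he
  refine le_liminf_div_log (mul_nonneg hL.le hq') (mul_lt_mul_of_pos_left hq hL) he ?_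
  filter_upwards [eventually_ge_atTop 2] with n hn
  have hlog : 0 < Real.log n := Real.log_pos (by exact_mod_cast hn)
  have hpt : ∀ ω : Path V K S n, ENNReal.ofReal (L * q * Real.log n) ≤ (netPulls j ω : ℝ≥0∞) +
      (ENNReal.ofReal L * ∑ v, (pullsAfter G j v (a₁ v * Real.log n) ω : ℝ≥0∞) +
        ENNReal.ofReal (L * q * Real.log n) *
          ∑ v, ind ((nbhdPulls G j v ω : ℝ) < q * Real.log n)) := by
    intro ω
    by_cases hall : ∀ v, q * Real.log n ≤ nbhdPulls G j v ω
    · have h1 := graphConst_mul_le_netPulls G j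
        (c := fun v => max (a₁ v * Real.log n) (q * Real.log n)) (fun v => le_max_right _ _) ω hall
      have h2 : ∑ v, (pullsAfter G j v (max (a₁ v * Real.log n) (q * Real.log n)) ω : ℝ) ≤
          ∑ v, (pullsAfter G j v (a₁ v * Real.log n) ω : ℝ) :=
        Finset.sum_le_sum fun v _ => Nat.cast_le.mpr (pullsAfter_anti G j v (le_max_left _ _) ω)
      have h3 := mul_le_mul_of_nonneg_left h2 hL.le
      rw [← add_assoc]
      refine le_trans ?_ le_self_add
      rw [← Nat.cast_sum, ← ENNReal.ofReal_natCast, ← ENNReal.ofReal_natCast (∑ v, _),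
        ← ENNReal.ofReal_mul hL.le, ← ENNReal.ofReal_add (Nat.cast_nonneg _) (by positivity)]
      refine ENNReal.ofReal_le_ofReal ?_
      push_cast
      rw [mul_assoc]
      linarith
    · push Not at hall
      obtain ⟨v, hv⟩ := hall
      refine le_trans (le_trans ?_ le_add_self) le_add_self
      refine le_mul_of_one_le_right' ?_
      calc (1 : ℝ≥0∞) = ind ((nbhdPulls G j v ω : ℝ) < q * Real.log n) := (ind_of hv).symm
        _ ≤ _ := Finset.single_le_sum
          (f := fun v => ind ((nbhdPulls G j v ω : ℝ) < q * Real.log n))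
          (fun _ _ => zero_le) (Finset.mem_univ v)
  have hint := sysExpect_mono (netPolicy Φ) (fun _ k => f (θ k)) hpt
  rw [sysExpect_const, sysExpect_add, sysExpect_add, sysExpect_const_mul, sysExpect_const_mul,
    sysExpect_sum, sysExpect_sum] at hint
  rw [expect_eq_sysExpect]
  refine hint.trans (add_le_add_right ?_ _)
  rw [add_mul, ENNReal.div_mul_cancel (by simpa using hlog) ENNReal.ofReal_ne_top,
    mul_right_comm (ENNReal.ofReal (L * q)),
    ← ENNReal.ofReal_mul (mul_nonneg hL.le (hq'.trans hq.le))]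
  refine add_le_add_left (mul_le_mul_right (Finset.sum_le_sum fun v _ => ?_) _) _
  exact h v n j hj Φ rfl

end Main

end NetBandit

end

theorem theorem3 {V : Type*} [Fintype V] (G : SimpleGraph V) {K : ℕ} {S : Set ℝ} {Θ : Type*}
    (f : Θ → PMF S)
    (hfull : ∀ (β : Θ) (x : S), f β x ≠ 0)
    (hmean : ∀ β : Θ, Integrable (fun x : S => (x : ℝ)) (f β).toMeasure)
    (hA1 : A1 f)
    (Φ : (v : V) → Policy G K S v) (hΦ : ∀ v, NAIC f v (Φ v))
    (θ : Fin K → Θ) (j : Fin K) (hj : Suboptimal f θ j)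
    (star : Fin K) (hstar : Optimal f θ star)
    (δ : ℝ) (hδ0 : 0 < δ) (hδ1 : δ < 1) :
    (∀ (v : V) (b : OutsidePath G K S v),
      ENNReal.ofReal ((1 - δ) / (1 + δ)) * (1 / kl f (θ j) (θ star)) ≤
        liminf (fun n : ℕ => (condExpect f Φ θ v b n fun ω => (nbhdPulls G j v ω : ℝ≥0∞)) /
          ENNReal.ofReal (Real.log n)) atTop) ∧
    (∀ v : V,
      ENNReal.ofReal ((1 - δ) / (1 + δ)) * (1 / kl f (θ j) (θ star)) ≤
        liminf (fun n : ℕ => (expect f Φ θ n fun ω => (nbhdPulls G j v ω : ℝ≥0∞)) /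
          ENNReal.ofReal (Real.log n)) atTop) ∧
    ENNReal.ofReal (graphConst G) * ENNReal.ofReal ((1 - δ) / (1 + δ)) *
        (1 / kl f (θ j) (θ star)) ≤
      liminf (fun n : ℕ => (expect f Φ θ n fun ω => (netPulls j ω : ℝ≥0∞)) /
        ENNReal.ofReal (Real.log n)) atTop := by
  have hjs : mean (f (θ j)) < mean (f (θ star)) := by
    obtain ⟨k, hk⟩ := hj
    exact hk.trans_le (hstar k)
  obtain ⟨hpos, hfin⟩ := hA1.pos_finite _ _ hjs
  set κ : ℝ := (kl f (θ j) (θ star)).toReal with hκ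
  have hκ0 : 0 < κ := ENNReal.toReal_pos hpos.ne' hfin.ne
  set q' : ℝ := (1 - δ) / (1 + δ) * (1 / κ) with hq'
  have hδ : (1 - δ) / (1 + δ) < 1 := by rw [div_lt_one (by linarith)]; linarith
  have hδ' : 0 ≤ (1 - δ) / (1 + δ) := div_nonneg (by linarith) (by linarith)
  have hq0 : 0 ≤ q' := by positivity
  have hlt : q' < 1 / κ := mul_lt_of_lt_one_left (by positivity) hδ
  -- The factor `(1 - δ) / (1 + δ) < 1` leaves room on both sides of `q`: below it to absorb
  -- vanishing errors in the liminf, above it for the change of measure.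
  obtain ⟨q, hq1, hq2⟩ := exists_between hlt
  have hq : 0 < q := hq0.trans_lt hq1
  have hqκ : q * κ < 1 := by rwa [lt_div_iff₀ hκ0] at hq2
  have htarget : ENNReal.ofReal ((1 - δ) / (1 + δ)) * (1 / kl f (θ j) (θ star)) =
      ENNReal.ofReal q' := by
    rw [hq', ENNReal.ofReal_mul hδ', ENNReal.ofReal_div_of_pos hκ0, ENNReal.ofReal_one, hκ,
      ENNReal.ofReal_toReal hfin.ne]
  refine ⟨fun v b => ?_, fun v => ?_, ?_⟩
  · rw [htarget]
    simp only [condExpect_eq_sysExpect]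
    exact le_liminf_sysExpect _ _ (fun n x => nbhdPulls G j v (glue b x)) hq0 hq1
      (tendsto_condExpect_nbhdPulls_lt hfull hA1 (hΦ v).2 hj hstar b hq hqκ)
  · rw [htarget]
    simp only [expect_eq_sysExpect]
    exact le_liminf_sysExpect _ _ (fun n ω => nbhdPulls G j v ω) hq0 hq1
      (tendsto_expect_nbhdPulls_lt hfull hA1 (hΦ v).1 hj hstar hq hqκ)
  · rw [mul_assoc, htarget, ← ENNReal.ofReal_mul (graphConst_nonneg G)]
    exact le_liminf_netPulls (fun v => (hΦ v).1) hj hq0 hq1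
      fun v => tendsto_expect_nbhdPulls_lt hfull hA1 (hΦ v).1 hj hstar hq hqκ
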